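/- Let $(M,J,g)$ be an almost Hermitian manifold of real dimension $2n$: $M$ is a smooth manifold, $J$ is a smooth almost complex structure on $M$ (not assumed integrable) and $g$ is a smooth Riemannian metric with $g(JX,JY)=g(X,Y)$. Let $\omega(X,Y)=g(JX,Y)$ be the fundamental form (not assumed closed) and let $\mathcal A=\bigoplus_{p,q}\mathcal A^{p,q}$ be the bigraded algebra of smooth complex valued differential forms. Let $\partial$ be the component of bidegree $(1,0)$ of the exterior differential $d$, let $\star$ be the complex linear Hodge star operator defined by $\xi\wedge\star\bar\eta=\langle\xi,\eta\rangle\,\omega^n/n!$, let $\bar\partial^*=-\star\,\partial\,\star$, $L\eta=\omega\wedge\eta$ and $\Lambda=L^*=\star^{-1}L\,\star$, and let $[\Lambda,\bar\partial^*]=\Lambda\bar\partial^*-\bar\partial^*\Lambda$. Then for every $q\ge 0$ and every $\alpha\in\mathcal A^{0,q}$, $$\Lambda\,\partial\alpha \;=\; i\,\bar\partial^*\alpha \;+\; i\,[\Lambda,\bar\partial^*]\,L\alpha .$$ -/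

import Mathlib

open scoped Manifold ContDiff
open Bundle

noncomputable section

namespace AlmostHermitian

/-! ## Complex valued forms on a real vector space -/

section Linear

variable {V : Type*} [AddCommGroup V] [Module ℝ V]

/-- The graded space of complex valued alternating forms on `V`: an element is a family
`η 0, η 1, η 2, …`, where `η k` is a complex valued alternating `k`-form. -/
abbrev Forms (V : Type*) [AddCommGroup V] [Module ℝ V] : Type _ :=
  ∀ k : ℕ, V [⋀^Fin k]→ₗ[ℝ] ℂ

/-- The constant `0`-form `1`. -/
def oneForm : Forms V :=
  Pi.single 0 (AlternatingMap.constOfIsEmpty ℝ V (Fin 0) (1 : ℂ))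

/-- The wedge product `θ ∧ η` of a covector `θ` with a form `η`:
`(θ ∧ η)(v₀, …, v_k) = ∑ i, (-1)^i θ(v_i) η(v₀, …, v̂_i, …, v_k)`. -/
def wedgeCovector (θ : V →ₗ[ℝ] ℂ) (η : Forms V) : Forms V
  | 0 => 0
  | k + 1 => AlternatingMap.alternatizeUncurryFin (θ.smulRight (η k))

/-- The wedge product `σ ∧ η` of a (real) `2`-form `σ` with a form `η`.  With `ι_u σ = σ(u, ·)`,
it is `1/2 ∑ i, (-1)^i ((ι_{v_i} σ) ∧ η)(v₀, …, v̂_i, …, v_{k+1})`, that is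
`∑_{i<j} (-1)^(i+j-1) σ(v_i, v_j) η(v₀, …, v̂_i, …, v̂_j, …, v_{k+1})`. -/
def wedgeTwoForm (σ : V [⋀^Fin 2]→ₗ[ℝ] ℝ) (η : Forms V) : Forms V
  | 0 => 0
  | 1 => 0
  | k + 2 => (1 / 2 : ℂ) • AlternatingMap.alternatizeUncurryFin
      (AlternatingMap.alternatizeUncurryFinLM ∘ₗ
        (LinearMap.mk₂ ℝ (fun u w : V => σ ![u, w] • η k)
          (fun u u' w => by
            rw [← add_smul]; congr 1; exact σ.map_vecCons_add _ _ _)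
          (fun c u w => by
            rw [smul_smul]; congr 1; exact σ.map_vecCons_smul _ _ _)
          (fun u w w' => by
            rw [← add_smul]; congr 1
            simpa using (σ.curryLeft u).map_vecCons_add ![] w w')
          (fun c u w => by
            rw [smul_smul]; congr 1
            simpa using (σ.curryLeft u).map_vecCons_smul ![] c w)))

/-- The interior product `ι_v η = η(v, ·, …, ·)`. -/
def contract (v : V) (η : Forms V) : Forms V :=
  fun k => (η (k + 1)).curryLeft v

end Linear

/-! ## Hermitian vector spaces -/

/-- A linear Hermitian structure on a real vector space: a complex structure `J` and a compatible
inner product `g`. -/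
structure HermitianStructure (V : Type*) [AddCommGroup V] [Module ℝ V] where
  /-- the complex structure -/
  J : V →ₗ[ℝ] V
  /-- the inner product -/
  g : V →ₗ[ℝ] V →ₗ[ℝ] ℝ
  J_sq : ∀ v, J (J v) = -v
  symm : ∀ v w, g v w = g w v
  pos : ∀ v, v ≠ 0 → 0 < g v v
  compat : ∀ v w, g (J v) (J w) = g v w

namespace HermitianStructure

variable {V : Type*} [AddCommGroup V] [Module ℝ V] (h : HermitianStructure V)

/-- The fundamental form `ω(u, v) = g(Ju, v)`. -/
def omega : V [⋀^Fin 2]→ₗ[ℝ] ℝ where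
  toFun v := h.g (h.J (v 0)) (v 1)
  map_update_add' v i x y := by
    fin_cases i <;> simp [Function.update]
  map_update_smul' v i c x := by
    fin_cases i <;> simp [Function.update]
  map_eq_zero_of_eq' v i j hv hij := by
    have key : ∀ u, h.g (h.J u) u = 0 := by
      intro u
      have h1 := h.compat (h.J u) u
      rw [h.J_sq, map_neg, LinearMap.neg_apply, h.symm u (h.J u)] at h1
      linarith
    have h01 : v 0 = v 1 := by
      fin_cases i <;> fin_cases j <;> simp_all
    change h.g (h.J (v 0)) (v 1) = 0
    rw [h01]
    exact key _

/-- The Lefschetz operator `L η = ω ∧ η`. -/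
def L (η : Forms V) : Forms V := wedgeTwoForm h.omega η

/-- The volume form `ωⁿ / n!`, where `2n` is the real dimension. -/
def vol : Forms V :=
  (1 / ((Module.finrank ℝ V / 2).factorial : ℂ)) • h.L^[Module.finrank ℝ V / 2] oneForm

/-- Orthonormal bases exist. -/
theorem exists_orthonormal [FiniteDimensional ℝ V] :
    ∃ e : Module.Basis (Fin (Module.finrank ℝ V)) ℝ V,
      ∀ i j, h.g (e i) (e j) = if i = j then 1 else 0 := by
  obtain ⟨v, hv⟩ := LinearMap.BilinForm.exists_orthogonal_basis (B := h.g)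
    (by constructor; intro x y; simpa using h.symm x y)
  have hp : ∀ i, 0 < h.g (v i) (v i) := fun i => h.pos _ (v.ne_zero i)
  have hs : ∀ i, Real.sqrt (h.g (v i) (v i)) ≠ 0 := fun i => (Real.sqrt_pos.2 (hp i)).ne'
  refine ⟨v.unitsSMul fun i => (Units.mk0 _ (hs i))⁻¹, fun i j => ?_⟩
  by_cases hij : i = j
  · subst hij
    simp only [Module.Basis.unitsSMul_apply, Units.smul_def, Units.val_inv_eq_inv_val,
      Units.val_mk0, map_smul, LinearMap.smul_apply, smul_eq_mul, if_true]
    have := Real.mul_self_sqrt (hp i).le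
    have h2 := hs i
    field_simp
    rw [sq, this]
  · have h0 : h.g (v i) (v j) = 0 := hv hij
    simp [Module.Basis.unitsSMul_apply, Units.smul_def, hij, h0]

/-- A chosen orthonormal basis. -/
def frame [FiniteDimensional ℝ V] : Module.Basis (Fin (Module.finrank ℝ V)) ℝ V :=
  h.exists_orthonormal.choose

/-- The (complex linear) Hodge star operator, characterized by `ξ ∧ ⋆η̄ = ⟨ξ, η⟩ vol`.
In an orthonormal basis `e₁, …, e_m`, for `η` of degree `k`,
`⋆η = 1/k! ∑_{i₁,…,i_k} η(e_{i₁}, …, e_{i_k}) vol(e_{i₁}, …, e_{i_k}, ·, …, ·)`. -/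
def hodgeStar [FiniteDimensional ℝ V] (η : Forms V) : Forms V :=
  ∑ k ∈ Finset.range (Module.finrank ℝ V + 1), (1 / (k.factorial : ℂ)) •
    ∑ I : Fin k → Fin (Module.finrank ℝ V),
      η k (fun a => h.frame (I a)) •
        (List.ofFn fun a => h.frame (I a)).foldl (fun ζ v => contract v ζ) h.vol

/-- The inverse of the Hodge star operator: as the real dimension is even,
`⋆⋆ = (-1)^k` on `k`-forms. -/
def starInv [FiniteDimensional ℝ V] (η : Forms V) : Forms V :=
  fun k => (-1 : ℂ) ^ k • h.hodgeStar η k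

/-- The dual Lefschetz operator `Λ = ⋆⁻¹ L ⋆`. -/
def Lam [FiniteDimensional ℝ V] (η : Forms V) : Forms V := h.starInv (h.L (h.hodgeStar η))

/-! ### Bidegree -/

/-- Products `θ₁ ∧ ⋯ ∧ θ_k` (in any order) of `p` covectors of type `(1,0)`, i.e. `θ ∘ J = iθ`,
and `q` covectors of type `(0,1)`, i.e. `θ ∘ J = -iθ`. -/
inductive IsProduct : ℕ → ℕ → Forms V → Prop
  | one : IsProduct 0 0 oneForm
  | holo {p q : ℕ} {η : Forms V} (θ : V →ₗ[ℝ] ℂ) (hθ : ∀ v, θ (h.J v) = Complex.I * θ v)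
      (hη : IsProduct p q η) : IsProduct (p + 1) q (wedgeCovector θ η)
  | anti {p q : ℕ} {η : Forms V} (θ : V →ₗ[ℝ] ℂ) (hθ : ∀ v, θ (h.J v) = -Complex.I * θ v)
      (hη : IsProduct p q η) : IsProduct p (q + 1) (wedgeCovector θ η)

/-- The space `𝒜^{p,q}` of forms of type `(p,q)`: the complex span of the products of `p`
covectors of type `(1,0)` and `q` covectors of type `(0,1)`. -/
def typePQ (r : ℕ × ℕ) : Submodule ℂ (Forms V) :=
  Submodule.span ℂ {η | h.IsProduct r.1 r.2 η}


/-- Pullback of forms along a linear endomorphism. -/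
def pullback (A : V →ₗ[ℝ] V) : Module.End ℂ (Forms V) where
  toFun η := fun k => (η k).compLinearMap A
  map_add' _ _ := rfl
  map_smul' _ _ := rfl

theorem pullback_apply (A : V →ₗ[ℝ] V) (η : Forms V) (k : ℕ) (v : Fin k → V) :
    pullback A η k v = η k (fun i => A (v i)) := rfl

theorem pullback_wedgeCovector (A : V →ₗ[ℝ] V) (θ : V →ₗ[ℝ] ℂ) (η : Forms V) :
    pullback A (wedgeCovector θ η) = wedgeCovector (θ ∘ₗ A) (pullback A η) := by
  funext k
  cases k with
  | zero => ext v; simp [pullback_apply, wedgeCovector]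
  | succ k =>
    ext v
    simp [pullback_apply, wedgeCovector, AlternatingMap.alternatizeUncurryFin_apply]
    rfl

theorem wedgeCovector_smul_left (c : ℂ) (θ : V →ₗ[ℝ] ℂ) (η : Forms V) :
    wedgeCovector (c • θ) η = c • wedgeCovector θ η := by
  funext k
  cases k with
  | zero => ext v; simp [wedgeCovector]
  | succ k =>
    ext v
    simp [wedgeCovector, AlternatingMap.alternatizeUncurryFin_apply, Finset.mul_sum, mul_assoc,
      mul_left_comm]

theorem wedgeCovector_add_left (θ θ' : V →ₗ[ℝ] ℂ) (η : Forms V) :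
    wedgeCovector (θ + θ') η = wedgeCovector θ η + wedgeCovector θ' η := by
  funext k
  cases k with
  | zero => ext v; simp [wedgeCovector]
  | succ k =>
    ext v
    simp [wedgeCovector, AlternatingMap.alternatizeUncurryFin_apply, add_mul,
      Finset.sum_add_distrib]

/-- `θ ∧ ·` as a complex linear map. -/
def wedgeCovectorLM (θ : V →ₗ[ℝ] ℂ) : Module.End ℂ (Forms V) where
  toFun := wedgeCovector θ
  map_add' η η' := by
    funext k
    cases k with
    | zero => ext v; simp [wedgeCovector]
    | succ k =>
      ext v
      simp [wedgeCovector, AlternatingMap.alternatizeUncurryFin_apply,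
        Finset.sum_add_distrib]
  map_smul' c η := by
    funext k
    cases k with
    | zero => ext v; simp [wedgeCovector]
    | succ k =>
      ext v
      simp [wedgeCovector, AlternatingMap.alternatizeUncurryFin_apply, Finset.mul_sum,
        mul_left_comm]

/-- `2 (cos 1 + sin 1 J)` -/
def twist : V →ₗ[ℝ] V := (2 * Real.cos 1) • LinearMap.id + (2 * Real.sin 1) • h.J

theorem IsProduct.pullback_eq {p q : ℕ} {η : Forms V} (hη : h.IsProduct p q η) :
    pullback h.twist η =
      ((2 : ℂ) ^ (p + q) * Complex.exp (((p : ℂ) - q) * Complex.I)) • η := by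
  have hz : (2 * Real.cos 1 + 2 * Real.sin 1 * Complex.I : ℂ) = 2 * Complex.exp Complex.I := by
    have := Complex.exp_mul_I 1
    rw [one_mul] at this
    rw [this]; push_cast; ring
  have hz' : (2 * Real.cos 1 - 2 * Real.sin 1 * Complex.I : ℂ)
      = 2 * Complex.exp (-Complex.I) := by
    have := Complex.exp_mul_I (-1)
    rw [neg_one_mul, Complex.cos_neg, Complex.sin_neg] at this
    rw [this]; push_cast; ring
  induction hη with
  | one =>
    funext k
    cases k with
    | zero => ext v; simp [pullback_apply, oneForm]
    | succ k => ext v; simp [pullback_apply, oneForm]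
  | @holo p q η θ hθ _ ih =>
    have h1 : θ ∘ₗ h.twist = (2 * Complex.exp Complex.I) • θ := by
      ext v
      rw [← hz]
      simp [twist, hθ]
      ring
    rw [pullback_wedgeCovector, ih, h1, wedgeCovector_smul_left]
    change _ • wedgeCovectorLM θ _ = _ • wedgeCovectorLM θ η
    rw [map_smul, smul_smul]
    congr 1
    have : (((p + 1 : ℕ) : ℂ) - q) * Complex.I = ((p : ℂ) - q) * Complex.I + Complex.I := by
      push_cast; ring
    rw [this, Complex.exp_add]
    ring
  | @anti p q η θ hθ _ ih =>
    have h1 : θ ∘ₗ h.twist = (2 * Complex.exp (-Complex.I)) • θ := by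
      ext v
      rw [← hz']
      simp [twist, hθ]
      ring
    rw [pullback_wedgeCovector, ih, h1, wedgeCovector_smul_left]
    change _ • wedgeCovectorLM θ _ = _ • wedgeCovectorLM θ η
    rw [map_smul, smul_smul]
    congr 1
    have : ((p : ℂ) - ((q + 1 : ℕ) : ℂ)) * Complex.I
        = ((p : ℂ) - q) * Complex.I + -Complex.I := by
      push_cast; ring
    rw [this, Complex.exp_add]
    ring

/-- Forms of different types are linearly independent. -/
theorem iSupIndep_typePQ : iSupIndep h.typePQ := by
  have hinj : Function.Injective fun r : ℕ × ℕ =>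
      (2 : ℂ) ^ (r.1 + r.2) * Complex.exp (((r.1 : ℂ) - r.2) * Complex.I) := by
    rintro ⟨p, q⟩ ⟨p', q'⟩ hr
    simp only at hr
    have hn := congrArg norm hr
    have e1 : ∀ a b : ℕ, ‖Complex.exp (((a : ℂ) - b) * Complex.I)‖ = 1 := by
      intro a b
      have := Complex.norm_exp_ofReal_mul_I ((a : ℝ) - b)
      push_cast at this
      exact this
    rw [norm_mul, norm_mul, e1, e1, norm_pow, norm_pow] at hn
    simp only [Complex.norm_ofNat, mul_one] at hn
    have hs : p + q = p' + q' := Nat.pow_right_injective (le_refl 2) (by exact_mod_cast hn)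
    rw [hs] at hr
    have he := mul_left_cancel₀ (pow_ne_zero _ two_ne_zero) hr
    rw [Complex.exp_eq_exp_iff_exists_int] at he
    obtain ⟨m, hm⟩ := he
    have hm2 : ((p : ℂ) - q) = ((p' : ℂ) - q') + m * (2 * Real.pi) := by
      apply mul_right_cancel₀ Complex.I_ne_zero
      rw [hm]; ring
    have hm3 : ((p : ℝ) - q) = ((p' : ℝ) - q') + m * (2 * Real.pi) := by
      exact_mod_cast hm2
    have hm0 : m = 0 := by
      by_contra hm0
      have hmR : (m : ℝ) ≠ 0 := by exact_mod_cast hm0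
      apply irrational_pi
      refine ⟨(((p : ℚ) - q) - (p' - q')) / (2 * m), ?_⟩
      push_cast
      field_simp
      linarith
    subst hm0
    have h4 : (p : ℝ) - q = p' - q' := by simpa using hm3
    have h5 : (p : ℤ) - q = p' - q' := by exact_mod_cast h4
    ext <;> simp <;> omega
  refine ((Module.End.eigenspaces_iSupIndep (pullback h.twist)).comp hinj).mono fun r => ?_
  refine Submodule.span_le.2 fun η hη => ?_
  exact Module.End.mem_eigenspace_iff.2 (IsProduct.pullback_eq h hη)

theorem single_mem (k : ℕ) [FiniteDimensional ℝ V] :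
    ∀ η : V [⋀^Fin k]→ₗ[ℝ] ℂ, (Pi.single k η : Forms V) ∈ ⨆ r, h.typePQ r := by
  have hw : ∀ (θ : V →ₗ[ℝ] ℂ) (η : Forms V), η ∈ ⨆ r, h.typePQ r →
      wedgeCovector θ η ∈ ⨆ r, h.typePQ r := by
    intro θ η hη
    change η ∈ (⨆ r, h.typePQ r).comap (wedgeCovectorLM θ)
    revert η
    change (⨆ r, h.typePQ r) ≤ _
    refine iSup_le fun r => Submodule.span_le.2 fun η hη => ?_
    change wedgeCovector θ η ∈ ⨆ r, h.typePQ r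
    have hdec : θ = ((1 / 2 : ℂ) • (θ - Complex.I • (θ ∘ₗ h.J)))
        + ((1 / 2 : ℂ) • (θ + Complex.I • (θ ∘ₗ h.J))) := by
      ext v; simp; ring
    rw [hdec, wedgeCovector_add_left]
    refine add_mem ?_ ?_
    · rw [wedgeCovector_smul_left]
      refine Submodule.smul_mem _ _ (Submodule.mem_iSup_of_mem (r.1 + 1, r.2)
        (Submodule.subset_span (IsProduct.holo _ (fun v => ?_) hη)))
      simp [h.J_sq, mul_sub, ← mul_assoc]
      ring
    · rw [wedgeCovector_smul_left]
      refine Submodule.smul_mem _ _ (Submodule.mem_iSup_of_mem (r.1, r.2 + 1)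
        (Submodule.subset_span (IsProduct.anti _ (fun v => ?_) hη)))
      simp [h.J_sq, mul_add, ← mul_assoc]
      ring
  induction k with
  | zero =>
    intro η
    have : (Pi.single 0 η : Forms V) = η ![] • oneForm := by
      funext k
      cases k with
      | zero =>
        ext v
        simp [oneForm]
        congr 1
        exact Subsingleton.elim _ _
      | succ k => ext v; simp [oneForm]
    rw [this]
    exact Submodule.smul_mem _ _ (Submodule.mem_iSup_of_mem (0, 0)
      (Submodule.subset_span IsProduct.one))
  | succ k ih =>
    intro η
    let b := Module.finBasis ℝ V
    have : (Pi.single (k + 1) η : Forms V) = (1 / ((k : ℂ) + 1)) •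
        ∑ a, wedgeCovector (Complex.ofRealLI.toLinearMap ∘ₗ b.coord a)
          (Pi.single k (η.curryLeft (b a))) := by
      have hk : (k : ℂ) + 1 ≠ 0 := Nat.cast_add_one_ne_zero k
      funext l
      rcases Nat.eq_zero_or_pos l with rfl | hl
      · ext v; simp [wedgeCovector]
      obtain ⟨l, rfl⟩ : ∃ m, l = m + 1 := ⟨l - 1, by omega⟩
      by_cases hlk : l = k
      · subst hlk
        have e : ∑ a, AlternatingMap.alternatizeUncurryFin
            ((Complex.ofRealLI.toLinearMap ∘ₗ b.coord a).smulRight (η.curryLeft (b a)))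
            = (l + 1) • η := by
          rw [← AlternatingMap.alternatizeUncurryFin_curryLeft]
          have e2 : η.curryLeft = ∑ a,
              (Complex.ofRealLI.toLinearMap ∘ₗ b.coord a).smulRight (η.curryLeft (b a)) := by
            refine b.ext fun i => ?_
            rw [LinearMap.sum_apply, Finset.sum_eq_single i]
            · ext v; simp
            · intro a _ ha
              ext v; simp [ha.symm]
            · simp
          conv_rhs => rw [e2]
          simp_rw [← AlternatingMap.alternatizeUncurryFinLM_apply]
          rw [map_sum]
        simp only [Pi.single_eq_same, Pi.smul_apply, Finset.sum_apply, wedgeCovector]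
        rw [e]
        ext v
        simp
        field_simp
      · ext v
        simp [wedgeCovector, hlk, AlternatingMap.alternatizeUncurryFin_apply]
    rw [this]
    exact Submodule.smul_mem _ _ (Submodule.sum_mem _ fun a _ => hw _ _ (ih _))

theorem iSup_typePQ [FiniteDimensional ℝ V] : ⨆ r, h.typePQ r = ⊤ := by
  rw [eq_top_iff]
  intro η _
  have : η = ∑ k ∈ Finset.range (Module.finrank ℝ V + 1), (Pi.single k (η k) : Forms V) := by
    funext l
    by_cases hl : l < Module.finrank ℝ V + 1
    · rw [Finset.sum_apply, Finset.sum_eq_single l]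
      · simp
      · intro k _ hk; simp [hk.symm]
      · intro hn; simp at hn; omega
    · have : η l = 0 := by
        ext v
        refine (η l).map_linearDependent v fun hv => ?_
        have := hv.fintype_card_le_finrank
        simp at this
        omega
      rw [this, Finset.sum_apply, Finset.sum_eq_zero]
      intro k hk
      have : l ≠ k := by simp at hk; omega
      simp [this]
  rw [this]
  exact Submodule.sum_mem _ fun k _ => h.single_mem k _

/-- The direct sum decomposition into types: `𝒜 = 𝒜^{p,q} ⊕ ⨁_{(p',q') ≠ (p,q)} 𝒜^{p',q'}`. -/
theorem isCompl_typePQ [FiniteDimensional ℝ V] (r : ℕ × ℕ) :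
    IsCompl (h.typePQ r) (⨆ (s) (_ : s ≠ r), h.typePQ s) where
  disjoint := h.iSupIndep_typePQ r
  codisjoint := by
    rw [codisjoint_iff, eq_top_iff, ← h.iSup_typePQ]
    refine iSup_le fun s => ?_
    by_cases hs : s = r
    · subst hs; exact le_sup_left
    · exact le_sup_of_le_right (le_iSup₂_of_le s hs le_rfl)

/-- The projection `η ↦ η^{p,q}` onto the component of type `(p,q)`. -/
def component [FiniteDimensional ℝ V] (r : ℕ × ℕ) : Forms V →ₗ[ℂ] Forms V :=
  (h.typePQ r).projection _ (h.isCompl_typePQ r)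

end HermitianStructure

/-! ## Almost Hermitian manifolds -/

section Manifold

variable {E : Type*} [NormedAddCommGroup E] [NormedSpace ℝ E] [FiniteDimensional ℝ E]
variable {M : Type*} [TopologicalSpace M] [ChartedSpace E M]

instance instFiniteDimensionalTangentSpace (x : M) :
    FiniteDimensional ℝ (TangentSpace 𝓘(ℝ, E) x) :=
  inferInstanceAs (FiniteDimensional ℝ E)

variable (E M) in
/-- A field of complex valued forms on `M` (with no regularity). -/
abbrev FormField : Type _ := ∀ x : M, Forms (TangentSpace 𝓘(ℝ, E) x)

/-- On a finite-dimensional space, an alternating map is continuous. -/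
def toContinuous {k : ℕ} (f : E [⋀^Fin k]→ₗ[ℝ] ℂ) : E [⋀^Fin k]→L[ℝ] ℂ :=
  { f with
    cont := by
      let b := Module.finBasis ℝ E
      have : (fun v : Fin k → E => f v) = fun v => ∑ r : Fin k → Fin (Module.finrank ℝ E),
          (∏ i, b.repr (v i) (r i)) • f (fun i => b (r i)) := by
        funext v
        conv_lhs => rw [show v = fun i => ∑ j, b.repr (v i) j • b j from
          funext fun i => (b.sum_repr (v i)).symm]
        change f.toMultilinearMap _ = _
        rw [f.toMultilinearMap.map_sum]
        refine Finset.sum_congr rfl fun r _ => ?_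
        exact f.toMultilinearMap.map_smul_univ _ _
      change Continuous fun v : Fin k → E => f v
      rw [this]
      have h1 : ∀ j, Continuous fun u : E => b.repr u j := fun j =>
        LinearMap.continuous_of_finiteDimensional (b.coord j)
      have h2 : ∀ r : Fin k → Fin (Module.finrank ℝ E),
          Continuous fun v : Fin k → E => ∏ i, b.repr (v i) (r i) := fun r =>
        continuous_finsetProd _ fun i _ => (h1 (r i)).comp (continuous_apply i)
      exact continuous_finsetSum _ fun r _ => (h2 r).smul continuous_const }

/-- The degree `k` part of `α` in the chart at `x₀`: the pullback of `α` under the inverse of the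
chart, a differential form on the target of the chart in `E`. -/
def inChart (α : FormField E M) (x₀ : M) (k : ℕ) (y : E) : E [⋀^Fin k]→L[ℝ] ℂ :=
  toContinuous ((α ((extChartAt 𝓘(ℝ, E) x₀).symm y) k).compLinearMap
    (mfderiv 𝓘(ℝ, E) 𝓘(ℝ, E) (extChartAt 𝓘(ℝ, E) x₀).symm y).toLinearMap)

/-- Smooth differential forms: smooth in all the charts of the manifold. -/
def IsSmooth (α : FormField E M) : Prop :=
  ∀ (x₀ : M) (k : ℕ), ContDiffOn ℝ ∞ (inChart α x₀ k) (extChartAt 𝓘(ℝ, E) x₀).target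

/-- The exterior derivative, computed in a chart around each point. -/
def d (α : FormField E M) : FormField E M := fun x k =>
  match k with
  | 0 => 0
  | k + 1 => (extDeriv (inChart α x k) (extChartAt 𝓘(ℝ, E) x x)).toAlternatingMap.compLinearMap
      (mfderiv 𝓘(ℝ, E) 𝓘(ℝ, E) (extChartAt 𝓘(ℝ, E) x) x).toLinearMap

end Manifold

/-- An almost Hermitian structure on `M`: a smooth almost complex structure `J` and a smooth
Riemannian metric `g` with `g(Ju, Jv) = g(u, v)`. -/
structure AlmostHermitianStructure (E : Type*) [NormedAddCommGroup E] [NormedSpace ℝ E]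
    (M : Type*) [TopologicalSpace M] [ChartedSpace E M] [IsManifold 𝓘(ℝ, E) ∞ M] where
  /-- the almost complex structure -/
  J : ∀ x : M, TangentSpace 𝓘(ℝ, E) x →L[ℝ] TangentSpace 𝓘(ℝ, E) x
  /-- the Riemannian metric -/
  g : ContMDiffRiemannianMetric 𝓘(ℝ, E) ∞ E (fun x : M => TangentSpace 𝓘(ℝ, E) x)
  J_smooth : ContMDiff 𝓘(ℝ, E) (𝓘(ℝ, E).prod 𝓘(ℝ, E →L[ℝ] E)) ∞
    (fun x : M => (TotalSpace.mk' (E →L[ℝ] E) x (J x) :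
      TotalSpace (E →L[ℝ] E)
        (fun x : M => TangentSpace 𝓘(ℝ, E) x →L[ℝ] TangentSpace 𝓘(ℝ, E) x)))
  J_sq : ∀ (x : M) (v : TangentSpace 𝓘(ℝ, E) x), J x (J x v) = -v
  compat : ∀ (x : M) (v w : TangentSpace 𝓘(ℝ, E) x),
    g.inner x (J x v) (J x w) = g.inner x v w

namespace AlmostHermitianStructure

variable {E : Type*} [NormedAddCommGroup E] [NormedSpace ℝ E]
variable {M : Type*} [TopologicalSpace M] [ChartedSpace E M] [IsManifold 𝓘(ℝ, E) ∞ M]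
variable (H : AlmostHermitianStructure E M)

/-- The Hermitian structure on the tangent space at `x`. -/
def tangent (x : M) : HermitianStructure (TangentSpace 𝓘(ℝ, E) x) where
  J := (H.J x).toLinearMap
  g := (ContinuousLinearMap.coeLM ℝ).comp (H.g.inner x).toLinearMap
  J_sq := H.J_sq x
  symm := H.g.symm x
  pos := H.g.pos x
  compat := H.compat x

variable [FiniteDimensional ℝ E]

/-- The Lefschetz operator `L`. -/
def L (α : FormField E M) : FormField E M := fun x => (H.tangent x).L (α x)

/-- The dual Lefschetz operator `Λ`. -/
def Lam (α : FormField E M) : FormField E M := fun x => (H.tangent x).Lam (α x)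

/-- The Hodge star operator. -/
def hodgeStar (α : FormField E M) : FormField E M := fun x => (H.tangent x).hodgeStar (α x)

/-- The component of type `(p,q)` of a form. -/
def component (r : ℕ × ℕ) (α : FormField E M) : FormField E M :=
  fun x => (H.tangent x).component r (α x)

/-- The operator `∂`, the part of bidegree `(1,0)` of `d`: it maps a form `α` of type `(p,q)` to the
component of type `(p+1,q)` of `dα`, and `∂α = ∑_{p,q} (d(α^{p,q}))^{p+1,q}` in general.  In degree
`k` only the terms with `p + q + 1 = k` contribute. -/
def del (α : FormField E M) : FormField E M := fun x k =>
  ∑ p ∈ Finset.range k, ∑ q ∈ Finset.range k,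
    H.component (p + 1, q) (d (H.component (p, q) α)) x k

/-- The operator `∂̄* = -⋆ ∂ ⋆`. -/
def delbarStar (α : FormField E M) : FormField E M := -H.hodgeStar (H.del (H.hodgeStar α))

end AlmostHermitianStructure

end AlmostHermitian
end

noncomputable section

namespace AlmostHermitian

/-! ### Exterior algebra of covectors: wedge products, contractions and their signs -/

section Operators

open HermitianStructure

variable {V : Type*} [AddCommGroup V] [Module ℝ V]

/-! Let the real dimension be `2n` and `n = q + m`. On forms of type `(0,q)` the Hodge star is a
power of `L`: `⋆α = c L^m α` with `c = c_q / m!` (`star_of_mem`). On forms of type `(1,q)` this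
dualizes to `Λβ = -i c ⋆ L^m β` (`dualLefschetz_of_mem_one`). Moreover `α` is primitive, so `ΛLα =
mα` and `⋆Lα = Λ⋆α = c m L^(m-1) α`.

Hence every `∂` in the identity is applied to a multiple of some `L^j α`. By the Leibniz rule `d(L^j
α) = j L^(j-1)(dω ∧ α) + L^j dα`. As `L^j α` has type `(j, q+j)` and `L` shifts types by `(1,1)`,
the `(1,0)` part is `∂(L^j α) = j L^(j-1) X + L^j Y`, where `Y = ∂α` and `X` is the `(2, q+1)` part
of `dω ∧ α` (`exists_del_lefschetzPow`). Neither `dω = 0` nor integrability is needed, because the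
same `X` serves for all `j`.

With `Λ⋆ = ⋆L`, the right-hand side becomes `⋆` of a combination of `L^(m-1) X` and `L^m Y`. The
term `i∂̄*α` gives `-i c ⋆(m L^(m-1) X + L^m Y)`. In the commutator the `Y` terms cancel, and the
coefficients `m - 1` and `m` of `X` differ by one, leaving `i c m ⋆ L^(m-1) X`. This removes the
torsion term, and what remains is `-i c ⋆ L^m Y = ΛY`. That computation is
`dualLefschetz_eq_commutator`.

The linear algebra rests on the rule `⋆(θ ∧ η) = (-1)^k ι_θ ⋆η` for `η` of degree `k`
(`star_wedgeCovectorLM`). Since forms are generated from `1` by wedging with covectors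
(`forms_induction`), the rule determines `⋆` from `⋆1 = vol`. It gives `⋆⋆ = (-1)^k` and identifies
`Λ = ⋆⁻¹L⋆` with a sum of double contractions, which supplies the `sl₂` commutation relations. -/

theorem wedgeCovectorLM_apply (θ : V →ₗ[ℝ] ℂ) (η : Forms V) :
    wedgeCovectorLM θ η = wedgeCovector θ η := rfl

theorem wedgeCovectorLM_zero_apply (θ : V →ₗ[ℝ] ℂ) (η : Forms V) :
    wedgeCovectorLM θ η 0 = 0 := rfl

theorem wedgeCovectorLM_succ_apply (θ : V →ₗ[ℝ] ℂ) (η : Forms V) (k : ℕ) :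
    wedgeCovectorLM θ η (k + 1) = AlternatingMap.alternatizeUncurryFin (θ.smulRight (η k)) := rfl

/-- The map `θ ↦ θ ∧ ·` as a complex linear map. -/
def wedgeCovectorHom : (V →ₗ[ℝ] ℂ) →ₗ[ℂ] Module.End ℂ (Forms V) where
  toFun := wedgeCovectorLM
  map_add' θ θ' := LinearMap.ext fun η => wedgeCovector_add_left θ θ' η
  map_smul' c θ := LinearMap.ext fun η => wedgeCovector_smul_left c θ η

theorem wedgeCovectorHom_apply (θ : V →ₗ[ℝ] ℂ) : wedgeCovectorHom θ = wedgeCovectorLM θ := rfl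

/-- Interior products with a vector as complex linear maps. -/
def contractLM (v : V) : Module.End ℂ (Forms V) where
  toFun := contract v
  map_add' _ _ := rfl
  map_smul' _ _ := rfl

theorem contractLM_apply (v : V) (η : Forms V) (k : ℕ) :
    contractLM v η k = (η (k + 1)).curryLeft v := rfl

/-- The operator acting as `(-1)^k` on `k`-forms. -/
def parity : Module.End ℂ (Forms V) where
  toFun η := fun k => (-1 : ℂ) ^ k • η k
  map_add' η η' := by funext k; simp
  map_smul' c η := by funext k; simp [smul_comm c]

theorem parity_apply (η : Forms V) (k : ℕ) : parity η k = (-1 : ℂ) ^ k • η k := rfl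

theorem parity_parity (η : Forms V) : parity (parity η) = η := by
  funext k
  rw [parity_apply, parity_apply, smul_smul, ← mul_pow]
  simp

theorem parity_wedgeCovectorLM (θ : V →ₗ[ℝ] ℂ) (η : Forms V) :
    parity (wedgeCovectorLM θ η) = -wedgeCovectorLM θ (parity η) := by
  funext k
  cases k with
  | zero => simp [parity_apply, wedgeCovectorLM_zero_apply]
  | succ k =>
    ext v
    simp [parity_apply, wedgeCovectorLM_succ_apply, AlternatingMap.alternatizeUncurryFin_apply,
      Finset.mul_sum, pow_succ, mul_left_comm]

theorem parity_contractLM (v : V) (η : Forms V) :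
    parity (contractLM v η) = -contractLM v (parity η) := by
  funext k
  ext w
  simp [parity_apply, contractLM_apply, pow_succ]

/-- The sum of the two sides is the double alternatization of `(u, w) ↦ (θ u φ w + φ u θ w) η`,
which is symmetric in `u` and `w` and therefore alternatizes to zero. -/
theorem wedgeCovectorLM_anticomm (θ φ : V →ₗ[ℝ] ℂ) (η : Forms V) :
    wedgeCovectorLM θ (wedgeCovectorLM φ η) = -wedgeCovectorLM φ (wedgeCovectorLM θ η) := by
  rw [eq_neg_iff_add_eq_zero]
  funext k
  match k with
  | 0 => simp [wedgeCovectorLM_zero_apply]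
  | 1 =>
    ext v
    simp [wedgeCovectorLM_succ_apply, wedgeCovectorLM_zero_apply,
      AlternatingMap.alternatizeUncurryFin_apply]
  | k + 2 =>
    let B (θ φ : V →ₗ[ℝ] ℂ) : V →ₗ[ℝ] V →ₗ[ℝ] V [⋀^Fin k]→ₗ[ℝ] ℂ :=
      LinearMap.mk₂ ℝ (fun u w : V => (θ u * φ w) • η k)
        (fun u u' w => by simp [add_mul, add_smul])
        (fun c u w => by
          rw [map_smul, Complex.real_smul, mul_assoc, ← Complex.real_smul, smul_assoc])
        (fun u w w' => by simp [mul_add, add_smul])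
        (fun c u w => by
          rw [map_smul, Complex.real_smul, mul_left_comm, ← Complex.real_smul, smul_assoc])
    have hB : ∀ θ φ, wedgeCovectorLM θ (wedgeCovectorLM φ η) (k + 2) =
        AlternatingMap.alternatizeUncurryFin
          (AlternatingMap.alternatizeUncurryFinLM ∘ₗ B θ φ) := by
      intro θ φ
      rw [wedgeCovectorLM_succ_apply, wedgeCovectorLM_succ_apply]
      congr 1
      ext u v
      simp [B, AlternatingMap.alternatizeUncurryFin_apply, Finset.mul_sum, mul_left_comm, mul_assoc]
    have hs := AlternatingMap.alternatizeUncurryFin_alternatizeUncurryFinLM_comp_of_symmetric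
      (f := B θ φ + B φ θ) (fun u w => by
        simp only [LinearMap.add_apply, B, LinearMap.mk₂_apply]
        rw [add_comm, mul_comm, mul_comm (θ u)])
    rw [Pi.add_apply, hB, hB, ← AlternatingMap.alternatizeUncurryFin_add, ← LinearMap.comp_add, hs]
    rfl

theorem wedgeCovectorLM_self (θ : V →ₗ[ℝ] ℂ) (η : Forms V) :
    wedgeCovectorLM θ (wedgeCovectorLM θ η) = 0 := by
  have h := wedgeCovectorLM_anticomm θ θ η
  have h2 : (2 : ℂ) • wedgeCovectorLM θ (wedgeCovectorLM θ η) = 0 := by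
    rw [two_smul]; nth_rewrite 1 [h]; simp
  exact (smul_eq_zero.1 h2).resolve_left two_ne_zero

theorem contractLM_anticomm (u v : V) (η : Forms V) :
    contractLM u (contractLM v η) = -contractLM v (contractLM u η) := by
  funext k
  ext w
  simp only [contractLM_apply, Pi.neg_apply, AlternatingMap.neg_apply,
    AlternatingMap.curryLeft_apply_apply]
  rw [← (η (k + 1 + 1)).map_swap (Matrix.vecCons u (Matrix.vecCons v w))
    (i := 0) (j := 1) (by simp)]
  congr 1
  funext i
  refine Fin.cases ?_ (fun i => Fin.cases ?_ (fun i => ?_) i) i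
  · simp
  · simp
  · simp only [Function.comp]
    rw [Equiv.swap_apply_of_ne_of_ne]
    · rfl
    · exact (Fin.succ_ne_zero _)
    · exact (fun h => Fin.succ_ne_zero _ (Fin.succ_injective _ h))

/-- Contraction is an antiderivation: in the alternating sum for `θ ∧ η`, the term in which `θ`
takes the first slot gives `θ v • η`, and in every other term `v` is inserted into `η` with one
extra sign. -/
theorem contractLM_wedgeCovectorLM (v : V) (θ : V →ₗ[ℝ] ℂ) (η : Forms V) :
    contractLM v (wedgeCovectorLM θ η) = θ v • η - wedgeCovectorLM θ (contractLM v η) := by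
  funext k
  ext w
  rw [contractLM_apply, wedgeCovectorLM_succ_apply]
  simp only [AlternatingMap.curryLeft_apply_apply, AlternatingMap.alternatizeUncurryFin_apply,
    Fin.sum_univ_succ]
  have h0 : (θ.smulRight (η k)) (Matrix.vecCons v w 0) (Fin.removeNth 0 (Matrix.vecCons v w))
      = θ v * η k w := by
    simp
  rw [Fin.val_zero, pow_zero, one_smul, h0]
  cases k with
  | zero => simp [wedgeCovectorLM_zero_apply]
  | succ k =>
    rw [Pi.sub_apply, AlternatingMap.sub_apply, wedgeCovectorLM_succ_apply,
      AlternatingMap.alternatizeUncurryFin_apply, sub_eq_add_neg, ← Finset.sum_neg_distrib]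
    congr 1
    refine Finset.sum_congr rfl fun i _ => ?_
    have h1 : i.succ.removeNth (Matrix.vecCons v w) = Matrix.vecCons v (i.removeNth w) := by
      funext j
      refine Fin.cases ?_ (fun j => ?_) j <;> simp [Fin.removeNth]
    rw [h1]
    simp [pow_succ, contractLM_apply]

/-- The complexified covector `σ(u, ·)`. -/
def contractTwoForm (σ : V [⋀^Fin 2]→ₗ[ℝ] ℝ) : V →ₗ[ℝ] V →ₗ[ℝ] ℂ :=
  LinearMap.mk₂ ℝ (fun u w : V => (σ ![u, w] : ℂ))
    (fun u u' w => by rw [← Complex.ofReal_add]; congr 1; exact σ.map_vecCons_add _ _ _)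
    (fun c u w => by
      rw [Complex.real_smul, ← Complex.ofReal_mul]; congr 1; exact σ.map_vecCons_smul _ _ _)
    (fun u w w' => by
      rw [← Complex.ofReal_add]; congr 1
      simpa using (σ.curryLeft u).map_vecCons_add ![] w w')
    (fun c u w => by
      rw [Complex.real_smul, ← Complex.ofReal_mul]; congr 1
      simpa using (σ.curryLeft u).map_vecCons_smul ![] c w)

theorem contractTwoForm_apply (σ : V [⋀^Fin 2]→ₗ[ℝ] ℝ) (u w : V) :
    contractTwoForm σ u w = (σ ![u, w] : ℂ) := rfl

/-- The complexification of a real covector. -/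
def complexify (φ : V →ₗ[ℝ] ℝ) : V →ₗ[ℝ] ℂ := Complex.ofRealLI.toLinearMap ∘ₗ φ

theorem complexify_apply (φ : V →ₗ[ℝ] ℝ) (v : V) : complexify φ v = (φ v : ℂ) := rfl

/-- Reduces all algebra with 2-forms to covector wedges, through `σ = 1/2 ∑ bⁱ ∧ σ(b_i, ·)`. -/
theorem wedgeTwoForm_eq_sum {ι : Type*} [Fintype ι] (b : Module.Basis ι ℝ V)
    (σ : V [⋀^Fin 2]→ₗ[ℝ] ℝ) (η : Forms V) :
    wedgeTwoForm σ η = (1 / 2 : ℂ) • ∑ i, wedgeCovectorLM (complexify (b.coord i))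
      (wedgeCovectorLM (contractTwoForm σ (b i)) η) := by
  funext k
  match k with
  | 0 => simp [wedgeTwoForm, wedgeCovectorLM_zero_apply]
  | 1 =>
    ext v
    simp [wedgeTwoForm, wedgeCovectorLM_succ_apply, wedgeCovectorLM_zero_apply,
      AlternatingMap.alternatizeUncurryFin_apply]
  | k + 2 =>
    simp only [wedgeTwoForm, Pi.smul_apply, Finset.sum_apply, wedgeCovectorLM_succ_apply]
    congr 1
    simp_rw [← AlternatingMap.alternatizeUncurryFinLM_apply]
    rw [← map_sum]
    congr 1
    refine b.ext fun j => ?_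
    classical
    rw [LinearMap.sum_apply, Finset.sum_eq_single j]
    · ext v
      simp [complexify_apply, AlternatingMap.alternatizeUncurryFin_apply, contractTwoForm_apply]
    · intro i _ hi
      ext v
      simp [complexify_apply, hi.symm]
    · simp

end Operators

/-! ### Commutation relations of `L` and `Λ` with covectors -/

namespace HermitianStructure

variable {V : Type*} [AddCommGroup V] [Module ℝ V] (h : HermitianStructure V)

/-- The covector `g(v, ·)`, with complex values. -/
def flat : V →ₗ[ℝ] V →ₗ[ℝ] ℂ := Complex.ofRealLI.toLinearMap.compRight ℝ ∘ₗ h.g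

theorem flat_apply (v w : V) : h.flat v w = (h.g v w : ℂ) := rfl

theorem g_J_left (v w : V) : h.g (h.J v) w = -h.g v (h.J w) := by
  have := h.compat v (h.J w)
  rw [h.J_sq, map_neg] at this
  linarith

theorem contractTwoForm_omega (v : V) : contractTwoForm h.omega v = h.flat (h.J v) := rfl

/-- `θ ∧ η` as a function of `θ`. -/
def wedgeAt (η : Forms V) : (V →ₗ[ℝ] ℂ) →ₗ[ℝ] Forms V :=
  (wedgeCovectorHom.flip η).restrictScalars ℝ

theorem wedgeAt_apply (η : Forms V) (θ : V →ₗ[ℝ] ℂ) : wedgeAt η θ = wedgeCovectorLM θ η := rfl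

/-- `ι_v η` as a function of `v`. -/
def contractAt (η : Forms V) : V →ₗ[ℝ] Forms V where
  toFun v := contractLM v η
  map_add' v w := by funext k; ext u; simp [contractLM_apply]
  map_smul' c v := by funext k; ext u; simp [contractLM_apply]

theorem contractAt_apply (η : Forms V) (v : V) : contractAt η v = contractLM v η := rfl

/-- The operator multiplying `k`-forms by `k`. -/
def degree : Module.End ℂ (Forms V) where
  toFun η := fun k => (k : ℂ) • η k
  map_add' η η' := by funext k; simp
  map_smul' c η := by funext k; simp [smul_comm c]

theorem degree_apply (η : Forms V) (k : ℕ) : degree η k = (k : ℂ) • η k := rfl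

variable [FiniteDimensional ℝ V]

theorem g_frame (i j : Fin (Module.finrank ℝ V)) :
    h.g (h.frame i) (h.frame j) = if i = j then 1 else 0 :=
  h.exists_orthonormal.choose_spec i j

theorem frame_coord (i : Fin (Module.finrank ℝ V)) : h.frame.coord i = h.g (h.frame i) := by
  refine h.frame.ext fun j => ?_
  rw [g_frame]
  simp [Finsupp.single_apply, eq_comm]

theorem complexify_frame_coord (i : Fin (Module.finrank ℝ V)) :
    complexify (h.frame.coord i) = h.flat (h.frame i) := by
  rw [frame_coord]; rfl

theorem sum_frame (v : V) : ∑ i, h.g (h.frame i) v • h.frame i = v := by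
  conv_rhs => rw [← h.frame.sum_repr v]
  refine Finset.sum_congr rfl fun i _ => ?_
  rw [← frame_coord]; rfl

theorem sum_frame_smul {W : Type*} [AddCommGroup W] [Module ℝ W] [Module ℂ W]
    [IsScalarTower ℝ ℂ W] (F : V →ₗ[ℝ] W) (v : V) :
    ∑ i, h.flat (h.frame i) v • F (h.frame i) = F v := by
  conv_rhs => rw [← h.sum_frame v, map_sum]
  refine Finset.sum_congr rfl fun i _ => ?_
  rw [map_smul, flat_apply]
  exact IsScalarTower.algebraMap_smul ℂ (h.g (h.frame i) v) (F (h.frame i))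

theorem sum_J_frame_smul {W : Type*} [AddCommGroup W] [Module ℝ W] [Module ℂ W]
    [IsScalarTower ℝ ℂ W] (F : V →ₗ[ℝ] W) (v : V) :
    ∑ i, h.flat (h.J (h.frame i)) v • F (h.frame i) = -F (h.J v) := by
  rw [← h.sum_frame_smul F, ← Finset.sum_neg_distrib]
  refine Finset.sum_congr rfl fun i _ => ?_
  rw [flat_apply, flat_apply, g_J_left]
  simp

/-- The Lefschetz operator as a complex linear map. -/
def lefschetz : Module.End ℂ (Forms V) :=
  (1 / 2 : ℂ) • ∑ i, wedgeCovectorLM (h.flat (h.frame i)) *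
    wedgeCovectorLM (h.flat (h.J (h.frame i)))

theorem lefschetz_apply (η : Forms V) : h.lefschetz η = (1 / 2 : ℂ) •
    ∑ i, wedgeCovectorLM (h.flat (h.frame i)) (wedgeCovectorLM (h.flat (h.J (h.frame i))) η) := by
  simp [lefschetz]

theorem L_eq (η : Forms V) : h.L η = h.lefschetz η := by
  rw [L, wedgeTwoForm_eq_sum h.frame, lefschetz_apply]
  simp_rw [complexify_frame_coord, contractTwoForm_omega]

theorem lefschetz_wedgeCovectorLM (θ : V →ₗ[ℝ] ℂ) (η : Forms V) :
    h.lefschetz (wedgeCovectorLM θ η) = wedgeCovectorLM θ (h.lefschetz η) := by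
  rw [lefschetz_apply, lefschetz_apply, map_smul, map_sum]
  congr 1
  refine Finset.sum_congr rfl fun i _ => ?_
  rw [wedgeCovectorLM_anticomm _ θ, map_neg, wedgeCovectorLM_anticomm _ θ, neg_neg]

theorem parity_lefschetz (η : Forms V) : parity (h.lefschetz η) = h.lefschetz (parity η) := by
  rw [lefschetz_apply, lefschetz_apply, map_smul, map_sum]
  congr 1
  refine Finset.sum_congr rfl fun i _ => ?_
  rw [parity_wedgeCovectorLM, parity_wedgeCovectorLM, map_neg, neg_neg]

/-- This is `ι_v ω = g(Jv, ·)`. In `ω = 1/2 ∑ e_i ∧ Je_i` the contraction hits either factor; as `J`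
is skew for `g`, both contributions equal `g(Jv, ·)`, which absorbs the factor `1/2`. -/
theorem contractLM_lefschetz (v : V) (η : Forms V) :
    contractLM v (h.lefschetz η) =
      h.lefschetz (contractLM v η) + wedgeCovectorLM (h.flat (h.J v)) η := by
  have h1 := h.sum_frame_smul (wedgeAt η ∘ₗ h.flat ∘ₗ h.J) v
  have h2 := h.sum_J_frame_smul (wedgeAt η ∘ₗ h.flat) v
  simp only [LinearMap.comp_apply, wedgeAt_apply] at h1 h2
  rw [lefschetz_apply, lefschetz_apply, map_smul, map_sum]
  have : wedgeCovectorLM (h.flat (h.J v)) η = (1 / 2 : ℂ) •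
      (wedgeCovectorLM (h.flat (h.J v)) η - -wedgeCovectorLM (h.flat (h.J v)) η) := by
    rw [sub_neg_eq_add, ← two_smul ℂ, smul_smul]; norm_num
  rw [this, ← smul_add]
  congr 1
  nth_rewrite 1 [← h1]
  rw [← h2, ← Finset.sum_sub_distrib, ← Finset.sum_add_distrib]
  refine Finset.sum_congr rfl fun i _ => ?_
  rw [contractLM_wedgeCovectorLM, contractLM_wedgeCovectorLM, map_sub, map_smul]
  abel

/-- The interior product with the vector dual to a complex covector. -/
def contractCovector (θ : V →ₗ[ℝ] ℂ) : Module.End ℂ (Forms V) :=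
  ∑ i, θ (h.frame i) • contractLM (h.frame i)

theorem contractCovector_apply (θ : V →ₗ[ℝ] ℂ) (η : Forms V) :
    h.contractCovector θ η = ∑ i, θ (h.frame i) • contractLM (h.frame i) η := by
  simp [contractCovector]

theorem contractCovector_flat (v : V) (η : Forms V) :
    h.contractCovector (h.flat v) η = contractLM v η := by
  rw [contractCovector_apply, ← contractAt_apply, ← h.sum_frame_smul (contractAt η)]
  refine Finset.sum_congr rfl fun i _ => ?_
  rw [flat_apply, flat_apply, h.symm, contractAt_apply]

theorem parity_contractCovector (θ : V →ₗ[ℝ] ℂ) (η : Forms V) :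
    parity (h.contractCovector θ η) = -h.contractCovector θ (parity η) := by
  rw [contractCovector_apply, contractCovector_apply, map_sum, ← Finset.sum_neg_distrib]
  refine Finset.sum_congr rfl fun i _ => ?_
  rw [map_smul, parity_contractLM, smul_neg]

theorem contractCovector_wedgeCovectorLM (θ φ : V →ₗ[ℝ] ℂ) (η : Forms V) :
    h.contractCovector θ (wedgeCovectorLM φ η) = (∑ i, θ (h.frame i) * φ (h.frame i)) • η -
      wedgeCovectorLM φ (h.contractCovector θ η) := by
  rw [contractCovector_apply, contractCovector_apply, map_sum, Finset.sum_smul,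
    ← Finset.sum_sub_distrib]
  refine Finset.sum_congr rfl fun i _ => ?_
  rw [contractLM_wedgeCovectorLM, smul_sub, smul_smul, map_smul]

theorem sum_frame_mul_flat (θ : V →ₗ[ℝ] ℂ) (v : V) :
    ∑ i, θ (h.frame i) * h.flat v (h.frame i) = θ v := by
  rw [← h.sum_frame_smul θ v]
  refine Finset.sum_congr rfl fun i _ => ?_
  rw [flat_apply, flat_apply, h.symm, smul_eq_mul, mul_comm]

/-- The `(0,1)`-covectors are isotropic for the complex bilinear extension of `g`: moving `J` from
one factor to the other changes the sign, while both factors have the same eigenvalue `-i`. -/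
theorem sum_anti_mul_anti {θ φ : V →ₗ[ℝ] ℂ} (hθ : ∀ v, θ (h.J v) = -Complex.I * θ v)
    (hφ : ∀ v, φ (h.J v) = -Complex.I * φ v) :
    ∑ i, θ (h.frame i) * φ (h.frame i) = 0 := by
  have key : ∑ i, θ (h.frame i) * φ (h.J (h.frame i)) =
      -∑ i, θ (h.J (h.frame i)) * φ (h.frame i) := by
    calc _ = ∑ i, θ (h.frame i) * ∑ j, h.flat (h.frame j) (h.J (h.frame i)) • φ (h.frame j) := by
          simp_rw [h.sum_frame_smul φ]
      _ = ∑ j, (∑ i, h.flat (h.frame j) (h.J (h.frame i)) • θ (h.frame i)) * φ (h.frame j) := by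
          simp_rw [Finset.mul_sum, Finset.sum_mul]
          rw [Finset.sum_comm]
          simp only [smul_eq_mul]
          refine Finset.sum_congr rfl fun i _ => Finset.sum_congr rfl fun j _ => by ring
      _ = _ := by
          rw [← Finset.sum_neg_distrib]
          refine Finset.sum_congr rfl fun j _ => ?_
          rw [← neg_mul, ← h.sum_J_frame_smul θ]
          congr 1
          refine Finset.sum_congr rfl fun i _ => ?_
          rw [flat_apply, flat_apply, h.symm]
  simp_rw [hφ, hθ] at key
  have e1 : ∑ i, θ (h.frame i) * (-Complex.I * φ (h.frame i)) =
      -Complex.I * ∑ i, θ (h.frame i) * φ (h.frame i) := by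
    rw [Finset.mul_sum]; exact Finset.sum_congr rfl fun i _ => by ring
  have e2 : ∑ i, (-Complex.I * θ (h.frame i)) * φ (h.frame i) =
      -Complex.I * ∑ i, θ (h.frame i) * φ (h.frame i) := by
    rw [Finset.mul_sum]; exact Finset.sum_congr rfl fun i _ => by ring
  rw [e1, e2] at key
  have : (-Complex.I) * ∑ i, θ (h.frame i) * φ (h.frame i) = 0 := by linear_combination key / 2
  exact (mul_eq_zero.1 this).resolve_left (neg_ne_zero.2 Complex.I_ne_zero)

/-- For a covector `θ` with `θ ∘ J = c θ`, one has `[ι_θ, L] = -c θ ∧ ·`. -/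
theorem contractCovector_lefschetz {θ : V →ₗ[ℝ] ℂ} {c : ℂ} (hθ : ∀ v, θ (h.J v) = c * θ v)
    (η : Forms V) :
    h.contractCovector θ (h.lefschetz η) =
      h.lefschetz (h.contractCovector θ η) - c • wedgeCovectorLM θ η := by
  have e : -(c • θ) = ∑ i, θ (h.frame i) • h.flat (h.J (h.frame i)) := by
    ext v
    have := h.sum_J_frame_smul θ v
    simp only [LinearMap.neg_apply, LinearMap.smul_apply, LinearMap.sum_apply, smul_eq_mul]
    rw [← hθ, ← this]
    exact Finset.sum_congr rfl fun i _ => by rw [smul_eq_mul, mul_comm]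
  have e2 : -(c • wedgeCovectorLM θ η) =
      ∑ i, θ (h.frame i) • wedgeCovectorLM (h.flat (h.J (h.frame i))) η := by
    simp only [← wedgeCovectorHom_apply]
    rw [← LinearMap.smul_apply, ← LinearMap.neg_apply, ← map_smul, ← map_neg, e]
    simp
  rw [sub_eq_add_neg, e2, contractCovector_apply, contractCovector_apply, map_sum,
    ← Finset.sum_add_distrib]
  refine Finset.sum_congr rfl fun i _ => ?_
  rw [contractLM_lefschetz, smul_add, map_smul]

/-- The dual Lefschetz operator as a sum of double contractions. -/
def dualLefschetz : Module.End ℂ (Forms V) :=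
  (1 / 2 : ℂ) • ∑ i, contractLM (h.J (h.frame i)) * contractLM (h.frame i)

theorem dualLefschetz_apply (η : Forms V) : h.dualLefschetz η = (1 / 2 : ℂ) •
    ∑ i, contractLM (h.J (h.frame i)) (contractLM (h.frame i) η) := by
  simp [dualLefschetz]

theorem parity_dualLefschetz (η : Forms V) :
    parity (h.dualLefschetz η) = h.dualLefschetz (parity η) := by
  rw [dualLefschetz_apply, dualLefschetz_apply, map_smul, map_sum]
  congr 1
  refine Finset.sum_congr rfl fun i _ => ?_
  rw [parity_contractLM, parity_contractLM, map_neg, neg_neg]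

/-- For a covector `ψ` with `ψ ∘ J = c ψ`, one has `[Λ, ψ ∧ ·] = -c ι_ψ`. -/
theorem dualLefschetz_wedgeCovectorLM {ψ : V →ₗ[ℝ] ℂ} {c : ℂ} (hψ : ∀ v, ψ (h.J v) = c * ψ v)
    (η : Forms V) :
    h.dualLefschetz (wedgeCovectorLM ψ η) =
      wedgeCovectorLM ψ (h.dualLefschetz η) - c • h.contractCovector ψ η := by
  have e1 : ∑ i, ψ (h.frame i) • contractLM (h.J (h.frame i)) η =
      -(c • h.contractCovector ψ η) := by
    have e : ∀ i, contractLM (h.J (h.frame i)) η =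
        ∑ j, h.flat (h.frame j) (h.J (h.frame i)) • contractLM (h.frame j) η := fun i =>
      (h.sum_frame_smul (contractAt η) _).symm
    simp_rw [e, Finset.smul_sum]
    rw [Finset.sum_comm, contractCovector_apply, Finset.smul_sum, ← Finset.sum_neg_distrib]
    refine Finset.sum_congr rfl fun j _ => ?_
    rw [smul_smul, ← hψ, ← neg_smul, ← h.sum_J_frame_smul ψ, Finset.sum_smul]
    refine Finset.sum_congr rfl fun i _ => ?_
    rw [smul_smul, flat_apply, flat_apply, h.symm, smul_eq_mul, mul_comm]
  have e2 : ∑ i, ψ (h.J (h.frame i)) • contractLM (h.frame i) η = c • h.contractCovector ψ η := by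
    rw [contractCovector_apply, Finset.smul_sum]
    exact Finset.sum_congr rfl fun i _ => by rw [hψ, smul_smul]
  have : -(c • h.contractCovector ψ η) = (1 / 2 : ℂ) •
      (-(c • h.contractCovector ψ η) - c • h.contractCovector ψ η) := by
    module
  rw [sub_eq_add_neg, this, dualLefschetz_apply, dualLefschetz_apply, map_smul, map_sum, ← smul_add]
  congr 1
  nth_rewrite 1 [← e1]
  rw [← e2, ← Finset.sum_sub_distrib, ← Finset.sum_add_distrib]
  refine Finset.sum_congr rfl fun i _ => ?_
  rw [contractLM_wedgeCovectorLM, map_sub, contractLM_wedgeCovectorLM, map_smul]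
  abel

/-- Euler's identity: expanding the first argument in the frame turns the sum into the
alternatization of the curried form, which counts each of the slots once. -/
theorem sum_wedgeCovectorLM_contractLM (η : Forms V) :
    ∑ i, wedgeCovectorLM (h.flat (h.frame i)) (contractLM (h.frame i) η) = degree η := by
  funext k
  cases k with
  | zero => simp [wedgeCovectorLM_zero_apply, degree_apply]
  | succ k =>
    simp only [Finset.sum_apply, wedgeCovectorLM_succ_apply, contractLM_apply, degree_apply]
    simp_rw [← AlternatingMap.alternatizeUncurryFinLM_apply]
    rw [← map_sum, AlternatingMap.alternatizeUncurryFinLM_apply]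
    have e : ∑ i, (h.flat (h.frame i)).smulRight ((η (k + 1)).curryLeft (h.frame i)) =
        (η (k + 1)).curryLeft := by
      ext v : 1
      rw [LinearMap.sum_apply]
      exact h.sum_frame_smul (η (k + 1)).curryLeft v
    rw [e, AlternatingMap.alternatizeUncurryFin_curryLeft]
    ext v; simp

theorem sum_wedgeCovectorLM_contractLM_J (η : Forms V) :
    ∑ i, wedgeCovectorLM (h.flat (h.J (h.frame i))) (contractLM (h.J (h.frame i)) η) =
      degree η := by
  have e : ∀ i, contractLM (h.J (h.frame i)) η =
      ∑ j, h.flat (h.frame j) (h.J (h.frame i)) • contractLM (h.frame j) η := fun i =>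
    (h.sum_frame_smul (contractAt η) _).symm
  simp_rw [e, map_sum, map_smul]
  rw [Finset.sum_comm, ← h.sum_wedgeCovectorLM_contractLM]
  refine Finset.sum_congr rfl fun j _ => ?_
  have h2 := h.sum_J_frame_smul (wedgeAt (contractLM (h.frame j) η) ∘ₗ h.flat ∘ₗ h.J) (h.frame j)
  simp only [LinearMap.comp_apply, wedgeAt_apply, h.J_sq, map_neg] at h2
  rw [neg_neg] at h2
  rw [← h2]
  refine Finset.sum_congr rfl fun i _ => ?_
  rw [flat_apply, flat_apply, h.symm]

/-- The `sl₂` relation `[Λ, L] = n - k` on `k`-forms, where the real dimension is `2n`. Each frame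
vector contributes `η` once from `g(Je_i, Je_i) = 1`, together with the two Euler terms for `e_i`
and `Je_i`; the total is `(2n - k - k) / 2`. -/
theorem dualLefschetz_lefschetz (η : Forms V) :
    h.dualLefschetz (h.lefschetz η) = h.lefschetz (h.dualLefschetz η) +
      (((Module.finrank ℝ V : ℂ) / 2) • η - degree η) := by
  have e : ((Module.finrank ℝ V : ℂ) / 2) • η - degree η = (1 / 2 : ℂ) •
      (∑ i : Fin (Module.finrank ℝ V), η
       - ∑ i, wedgeCovectorLM (h.flat (h.J (h.frame i))) (contractLM (h.J (h.frame i)) η)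
       - ∑ i, wedgeCovectorLM (h.flat (h.frame i)) (contractLM (h.frame i) η)) := by
    rw [sum_wedgeCovectorLM_contractLM_J, sum_wedgeCovectorLM_contractLM]
    simp only [Finset.sum_const, Finset.card_univ, Fintype.card_fin]
    rw [← Nat.cast_smul_eq_nsmul ℂ]
    module
  rw [e, dualLefschetz_apply, dualLefschetz_apply, map_smul, map_sum, ← smul_add]
  congr 1
  rw [← Finset.sum_sub_distrib, ← Finset.sum_sub_distrib, ← Finset.sum_add_distrib]
  refine Finset.sum_congr rfl fun i _ => ?_
  rw [contractLM_lefschetz, map_add, contractLM_lefschetz, contractLM_wedgeCovectorLM, flat_apply,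
    h.compat, g_frame, h.J_sq, map_neg]
  have : wedgeCovectorLM (-h.flat (h.frame i)) (contractLM (h.frame i) η) =
      -wedgeCovectorLM (h.flat (h.frame i)) (contractLM (h.frame i) η) := by
    rw [← wedgeAt_apply, map_neg, wedgeAt_apply]
  rw [this]
  simp
  abel

end HermitianStructure

/-! ### The Hodge star: recursion on covectors, involutivity, and the formula for `Λ` -/

section Contractions

variable {V : Type*} [AddCommGroup V] [Module ℝ V]

/-- Successive contraction with the vectors of a list, the first one innermost. -/
def contractList : List V → Module.End ℂ (Forms V)
  | [] => 1
  | v :: l => contractList l * contractLM v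

theorem foldl_contract (l : List V) (ζ : Forms V) :
    l.foldl (fun ζ v => contract v ζ) ζ = contractList l ζ := by
  induction l generalizing ζ with
  | nil => rfl
  | cons v l ih => rw [List.foldl_cons, ih]; rfl

theorem contractList_contractLM (l : List V) (v : V) (ζ : Forms V) :
    contractList l (contractLM v ζ) = (-1 : ℂ) ^ l.length • contractLM v (contractList l ζ) := by
  induction l generalizing ζ with
  | nil => simp [contractList]
  | cons u l ih =>
    simp only [contractList, Module.End.mul_apply, List.length_cons]
    rw [contractLM_anticomm, map_neg, ih, pow_succ]
    simp

/-- Bringing the contraction by `u j` outermost moves it past the `k - j` later ones, and `k - j`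
has the parity of `k + j`. -/
theorem contractList_ofFn {k : ℕ} (u : Fin (k + 1) → V) (j : Fin (k + 1)) (ζ : Forms V) :
    contractList (List.ofFn u) ζ =
      (-1 : ℂ) ^ (k + j : ℕ) • contractLM (u j) (contractList (List.ofFn (j.removeNth u)) ζ) := by
  induction k generalizing ζ with
  | zero =>
    obtain rfl : j = 0 := Fin.fin_one_eq_zero j
    simp [contractList]
  | succ k ih =>
    refine Fin.cases ?_ (fun j => ?_) j
    · rw [List.ofFn_succ, contractList, Module.End.mul_apply, contractList_contractLM,
        List.length_ofFn]
      rfl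
    · rw [List.ofFn_succ, contractList, Module.End.mul_apply, ih (fun i => u i.succ) j]
      rw [List.ofFn_succ (f := j.succ.removeNth u), contractList, Module.End.mul_apply]
      have e : (k + 1 + (j.succ : Fin (k + 2)) : ℕ) = (k + j) + 2 := by simp; omega
      have e1 : (j.succ.removeNth u) 0 = u 0 := rfl
      have e2 : (fun i => j.succ.removeNth u i.succ) = j.removeNth (fun i => u i.succ) := by
        funext i; simp [Fin.removeNth]
      rw [e, e1, e2, pow_add _ (k + j : ℕ), neg_one_sq, mul_one]

end Contractions

namespace HermitianStructure

variable {V : Type*} [AddCommGroup V] [Module ℝ V]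

theorem parity_oneForm : parity (oneForm : Forms V) = oneForm := by
  funext k
  rw [parity_apply]
  cases k with
  | zero => simp
  | succ k => simp [oneForm]

theorem contractLM_oneForm (v : V) : contractLM v (oneForm : Forms V) = 0 := by
  funext k
  ext w
  simp [contractLM_apply, oneForm]

theorem degree_wedgeCovectorLM (θ : V →ₗ[ℝ] ℂ) (η : Forms V) :
    degree (wedgeCovectorLM θ η) = wedgeCovectorLM θ (degree η) + wedgeCovectorLM θ η := by
  funext k
  cases k with
  | zero => simp [degree_apply, wedgeCovectorLM_zero_apply]
  | succ k =>
    ext v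
    simp [degree_apply, wedgeCovectorLM_succ_apply, AlternatingMap.alternatizeUncurryFin_apply,
      Finset.mul_sum, add_mul, Finset.sum_add_distrib, mul_left_comm]

theorem apply_eq_zero_of_degree {η : Forms V} {k l : ℕ} (hη : degree η = (k : ℂ) • η)
    (hl : l ≠ k) : η l = 0 := by
  have := congrFun hη l
  rw [degree_apply, Pi.smul_apply, ← sub_eq_zero, ← sub_smul, smul_eq_zero, sub_eq_zero] at this
  exact this.resolve_left fun h => hl (Nat.cast_injective h)

theorem degree_oneForm : degree (oneForm : Forms V) = (0 : ℂ) • oneForm := by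
  funext k
  rw [degree_apply]
  cases k with
  | zero => simp
  | succ k => simp [oneForm]

variable (h : HermitianStructure V) [FiniteDimensional ℝ V]

/-- The Hodge star operator on forms of degree `k`. -/
def starDegree (k : ℕ) (η : V [⋀^Fin k]→ₗ[ℝ] ℂ) : Forms V :=
  (1 / (k.factorial : ℂ)) • ∑ I : Fin k → Fin (Module.finrank ℝ V),
    η (fun a => h.frame (I a)) • contractList (List.ofFn fun a => h.frame (I a)) h.vol

theorem hodgeStar_eq_sum (η : Forms V) :
    h.hodgeStar η = ∑ k ∈ Finset.range (Module.finrank ℝ V + 1), h.starDegree k (η k) := by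
  simp only [hodgeStar, starDegree, foldl_contract]

theorem starDegree_smul (k : ℕ) (c : ℂ) (η : V [⋀^Fin k]→ₗ[ℝ] ℂ) :
    h.starDegree k (c • η) = c • h.starDegree k η := by
  simp only [starDegree, AlternatingMap.smul_apply, smul_assoc, ← Finset.smul_sum]
  rw [smul_comm]

theorem starDegree_add (k : ℕ) (η ζ : V [⋀^Fin k]→ₗ[ℝ] ℂ) :
    h.starDegree k (η + ζ) = h.starDegree k η + h.starDegree k ζ := by
  simp [starDegree, add_smul, Finset.sum_add_distrib]

theorem starDegree_zero (k : ℕ) : h.starDegree k 0 = 0 := by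
  simp [starDegree]

/-- The Hodge star operator as a complex linear map. -/
def star : Module.End ℂ (Forms V) where
  toFun := h.hodgeStar
  map_add' η ζ := by
    simp [hodgeStar_eq_sum, starDegree_add, Finset.sum_add_distrib]
  map_smul' c η := by
    simp [hodgeStar_eq_sum, starDegree_smul, Finset.smul_sum]

theorem hodgeStar_eq (η : Forms V) : h.hodgeStar η = h.star η := rfl

/-- The sign `(-1)^j` from the slot of `θ` in the wedge product meets `(-1)^(k+j)` from extracting
the `j`-th contraction. All `k + 1` slots thus contribute equally, and their number turns `1/(k+1)!`
into `1/k!`. -/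
theorem starDegree_wedge (k : ℕ) (θ : V →ₗ[ℝ] ℂ) (η : V [⋀^Fin k]→ₗ[ℝ] ℂ) :
    h.starDegree (k + 1) (AlternatingMap.alternatizeUncurryFin (θ.smulRight η)) =
      (-1 : ℂ) ^ k • h.contractCovector θ (h.starDegree k η) := by
  set n := Module.finrank ℝ V
  let e : Fin n → V := h.frame
  have key : ∀ j : Fin (k + 1), ∑ I : Fin (k + 1) → Fin n,
      (((-1 : ℤ) ^ (j : ℕ)) • (θ (e (I j)) * η (j.removeNth fun a => e (I a)))) •
        contractList (List.ofFn fun a => e (I a)) h.vol =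
      (-1 : ℂ) ^ k • h.contractCovector θ (∑ I : Fin k → Fin n,
        η (fun a => e (I a)) • contractList (List.ofFn fun a => e (I a)) h.vol) := by
    intro j
    -- A multi-index of length `k + 1` is split into its `j`-th entry, which feeds `θ`, and the
    -- remaining multi-index, which feeds `η`.
    rw [← (Fin.insertNthEquiv (fun _ => Fin n) j).sum_comp, Fintype.sum_prod_type,
      contractCovector_apply, Finset.smul_sum]
    refine Finset.sum_congr rfl fun i _ => ?_
    rw [map_sum, Finset.smul_sum, Finset.smul_sum]
    refine Finset.sum_congr rfl fun I _ => ?_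
    have hr : (j.removeNth fun a => e (Fin.insertNthEquiv (fun _ => Fin n) j (i, I) a)) =
        fun a => e (I a) := by
      funext a; simp [Fin.removeNth]
    rw [contractList_ofFn _ j, hr]
    simp only [Fin.insertNthEquiv_apply, Fin.insertNth_apply_same, map_smul, smul_smul]
    congr 1
    rw [zsmul_eq_mul]
    push_cast
    have : ((-1 : ℂ) ^ (j : ℕ)) * (-1) ^ (j : ℕ) = 1 := by rw [← mul_pow]; simp
    rw [pow_add]
    linear_combination (θ (e i) * η (fun a => e (I a)) * (-1) ^ k) * this
  have hk : ((k : ℂ) + 1) ≠ 0 := Nat.cast_add_one_ne_zero k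
  have hf : (k.factorial : ℂ) ≠ 0 := Nat.cast_ne_zero.2 k.factorial_ne_zero
  rw [starDegree, starDegree]
  simp only [AlternatingMap.alternatizeUncurryFin_apply, LinearMap.smulRight_apply,
    AlternatingMap.smul_apply, Finset.sum_smul]
  rw [Finset.sum_comm]
  have := Finset.sum_congr (rfl : (Finset.univ : Finset (Fin (k + 1))) = _) fun j _ => key j
  simp only [smul_eq_mul]
  refine (congrArg _ this).trans ?_
  simp only [Finset.sum_const, Finset.card_univ, Fintype.card_fin, map_smul]
  rw [← Nat.cast_smul_eq_nsmul ℂ, smul_smul, smul_smul, smul_smul, Nat.factorial_succ]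
  congr 1
  push_cast
  field_simp

theorem eq_zero_of_finrank_lt {k : ℕ} (hk : Module.finrank ℝ V < k) (η : V [⋀^Fin k]→ₗ[ℝ] ℂ) :
    η = 0 := by
  ext v
  refine η.map_linearDependent v fun hv => ?_
  have := hv.fintype_card_le_finrank
  simp at this
  omega

/-- The recursion that determines `⋆` from `⋆1 = vol`. The degrees at the two ends of the sums do no
harm: a wedge with a covector has no degree 0 part, and forms above the dimension vanish. -/
theorem star_wedgeCovectorLM (θ : V →ₗ[ℝ] ℂ) (η : Forms V) :
    h.star (wedgeCovectorLM θ η) = h.contractCovector θ (h.star (parity η)) := by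
  rw [← hodgeStar_eq, ← hodgeStar_eq, hodgeStar_eq_sum, hodgeStar_eq_sum, Finset.sum_range_succ',
    Finset.sum_range_succ, wedgeCovectorLM_zero_apply, starDegree_zero, add_zero, map_add, map_sum]
  have e : ∀ k, h.contractCovector θ (h.starDegree k (parity η k)) =
      h.starDegree (k + 1) (wedgeCovectorLM θ η (k + 1)) := by
    intro k
    rw [wedgeCovectorLM_succ_apply, starDegree_wedge, parity_apply, starDegree_smul, map_smul]
  simp_rw [e]
  rw [eq_zero_of_finrank_lt (Nat.lt_succ_self _) (wedgeCovectorLM θ η _), starDegree_zero, add_zero]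

theorem star_oneForm : h.star oneForm = h.vol := by
  rw [← hodgeStar_eq, hodgeStar_eq_sum, Finset.sum_eq_single 0]
  · simp [starDegree, oneForm, contractList]
  · intro k _ hk
    rw [oneForm, Pi.single_eq_of_ne hk, starDegree_zero]
  · simp

/-- A linear identity that is stable under wedge products with covectors may be checked on `1`. -/
theorem forms_induction (h : HermitianStructure V) {p : Forms V → Prop}
    (hadd : ∀ η ζ, p η → p ζ → p (η + ζ))
    (hsmul : ∀ (c : ℂ) η, p η → p (c • η)) (hone : p oneForm)
    (hwedge : ∀ θ η, p η → p (wedgeCovectorLM θ η)) (η : Forms V) : p η := by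
  have hprod : ∀ {a b : ℕ} {ζ : Forms V}, h.IsProduct a b ζ → p ζ := by
    intro a b ζ hζ
    induction hζ with
    | one => exact hone
    | holo θ _ _ ih => exact hwedge θ _ ih
    | anti θ _ _ ih => exact hwedge θ _ ih
  have hzero : p 0 := by simpa using hsmul 0 _ hone
  have hη : η ∈ ⨆ r, h.typePQ r := by rw [h.iSup_typePQ]; trivial
  induction hη using Submodule.iSup_induction' with
  | mem r ζ hζ =>
    induction hζ using Submodule.span_induction with
    | mem ζ hζ => exact hprod hζ
    | zero => exact hzero
    | add _ _ _ _ h1 h2 => exact hadd _ _ h1 h2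
    | smul c _ _ h1 => exact hsmul c _ h1
  | zero => exact hzero
  | add _ _ _ _ h1 h2 => exact hadd _ _ h1 h2

theorem vol_eq : h.vol = (1 / ((Module.finrank ℝ V / 2).factorial : ℂ)) •
    (h.lefschetz ^ (Module.finrank ℝ V / 2)) oneForm := by
  rw [vol, Module.End.pow_apply]
  congr 2
  funext η
  exact h.L_eq η

theorem parity_lefschetz_pow (m : ℕ) (η : Forms V) :
    parity ((h.lefschetz ^ m) η) = (h.lefschetz ^ m) (parity η) := by
  induction m with
  | zero => rfl
  | succ m ih =>
    rw [pow_succ', Module.End.mul_apply, parity_lefschetz, ih, Module.End.mul_apply]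

theorem lefschetz_pow_wedgeCovectorLM (m : ℕ) (θ : V →ₗ[ℝ] ℂ) (η : Forms V) :
    (h.lefschetz ^ m) (wedgeCovectorLM θ η) = wedgeCovectorLM θ ((h.lefschetz ^ m) η) := by
  induction m with
  | zero => rfl
  | succ m ih =>
    rw [pow_succ', Module.End.mul_apply, ih, lefschetz_wedgeCovectorLM, Module.End.mul_apply]

theorem parity_star (η : Forms V) : parity (h.star η) = h.star (parity η) := by
  refine h.forms_induction (p := fun η => parity (h.star η) = h.star (parity η))
    (fun η ζ h1 h2 => by simp only [map_add, h1, h2]) (fun c η h1 => by simp only [map_smul, h1])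
    ?_ (fun θ η h1 => ?_) η
  · rw [star_oneForm, parity_oneForm, star_oneForm, vol_eq, map_smul, parity_lefschetz_pow,
      parity_oneForm]
  · rw [star_wedgeCovectorLM, parity_contractCovector, ← h1, parity_parity,
      parity_wedgeCovectorLM, map_neg, star_wedgeCovectorLM, parity_parity]

/-- The complex structure forces the dimension to be even. -/
theorem two_mul_half_finrank (h : HermitianStructure V) :
    2 * (Module.finrank ℝ V / 2) = Module.finrank ℝ V := by
  refine Nat.two_mul_div_two_of_even ?_
  by_contra hodd
  have hJ : h.J * h.J = (-1 : ℝ) • (1 : Module.End ℝ V) := by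
    ext v; simp [h.J_sq]
  -- In odd dimension this would give `(det J)² = -1`.
  have hd := congrArg LinearMap.det hJ
  rw [map_mul, LinearMap.det_smul, map_one, (Nat.not_even_iff_odd.1 hodd).neg_one_pow] at hd
  nlinarith [mul_self_nonneg (LinearMap.det h.J)]

theorem finrank_div_two (h : HermitianStructure V) :
    (Module.finrank ℝ V : ℂ) / 2 = (Module.finrank ℝ V / 2 : ℕ) := by
  have := h.two_mul_half_finrank
  have h2 : (2 : ℂ) * (Module.finrank ℝ V / 2 : ℕ) = Module.finrank ℝ V := by exact_mod_cast this
  rw [← h2]; ring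

theorem degree_lefschetz (η : Forms V) :
    degree (h.lefschetz η) = h.lefschetz (degree η) + (2 : ℂ) • h.lefschetz η := by
  simp only [lefschetz_apply, map_smul, map_sum, degree_wedgeCovectorLM, map_add,
    Finset.sum_add_distrib]
  module

theorem degree_lefschetz_pow (m : ℕ) {η : Forms V} {k : ℂ} (hη : degree η = k • η) :
    degree ((h.lefschetz ^ m) η) = (k + 2 * m) • (h.lefschetz ^ m) η := by
  induction m with
  | zero => simpa using hη
  | succ m ih =>
    rw [pow_succ', Module.End.mul_apply, degree_lefschetz, ih, map_smul, ← add_smul]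
    congr 1
    push_cast; ring

/-- The commutation relation `[Λ, L^{m+1}] = (m + 1) (n - k - m) L^m` on primitive forms. -/
theorem dualLefschetz_lefschetz_pow (m : ℕ) {η : Forms V} {k : ℂ} (hη : degree η = k • η)
    (hprim : h.dualLefschetz η = 0) :
    h.dualLefschetz ((h.lefschetz ^ (m + 1)) η) =
      ((m + 1) * ((Module.finrank ℝ V / 2 : ℕ) - k - m) : ℂ) • (h.lefschetz ^ m) η := by
  induction m with
  | zero =>
    rw [zero_add, pow_one, dualLefschetz_lefschetz, hprim, h.finrank_div_two, hη]
    simp [sub_smul]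
  | succ m ih =>
    rw [pow_succ', Module.End.mul_apply, dualLefschetz_lefschetz, ih, map_smul,
      degree_lefschetz_pow h _ hη, h.finrank_div_two, ← Module.End.mul_apply, ← pow_succ', ← sub_smul,
      ← add_smul]
    congr 1
    push_cast; ring

/-- Each covector wedge in `L` becomes a contraction under `⋆`. The sign from the degree shift
cancels the one from reordering the two contractions. -/
theorem star_lefschetz (η : Forms V) : h.star (h.lefschetz η) = h.dualLefschetz (h.star η) := by
  rw [lefschetz_apply, dualLefschetz_apply, map_smul, map_sum]
  congr 1
  refine Finset.sum_congr rfl fun i _ => ?_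
  rw [star_wedgeCovectorLM, contractCovector_flat, parity_wedgeCovectorLM, map_neg,
    star_wedgeCovectorLM, parity_parity, contractCovector_flat, map_neg, contractLM_anticomm,
    neg_neg]

theorem dualLefschetz_oneForm : h.dualLefschetz oneForm = 0 := by
  simp [dualLefschetz_apply, contractLM_oneForm]

/-- Iterates the `sl₂` relation on the primitive form `1`: passing from `L^(r+1)` to `L^r` costs `(r
+ 1)(n - r)`, and here `n - r = m + 1`. -/
theorem dualLefschetz_pow_lefschetz_pow {m : ℕ} (hm : m ≤ Module.finrank ℝ V / 2) :
    (h.dualLefschetz ^ m) ((h.lefschetz ^ (Module.finrank ℝ V / 2)) oneForm) =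
      (((Module.finrank ℝ V / 2).factorial : ℂ) * m.factorial /
        (Module.finrank ℝ V / 2 - m).factorial) •
      (h.lefschetz ^ (Module.finrank ℝ V / 2 - m)) oneForm := by
  induction m with
  | zero =>
    simp [div_self, Nat.factorial_ne_zero]
  | succ m ih =>
    obtain ⟨r, hr⟩ := Nat.exists_eq_add_of_le hm
    rw [pow_succ', Module.End.mul_apply, ih (by omega), map_smul]
    have e1 : Module.finrank ℝ V / 2 - m = r + 1 := by omega
    have e2 : Module.finrank ℝ V / 2 - (m + 1) = r := by omega
    rw [e1, e2, dualLefschetz_lefschetz_pow h r degree_oneForm h.dualLefschetz_oneForm, smul_smul]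
    congr 1
    rw [Nat.factorial_succ, Nat.factorial_succ]
    have hr1 : (r : ℂ) + 1 ≠ 0 := Nat.cast_add_one_ne_zero r
    have hf : (r.factorial : ℂ) ≠ 0 := Nat.cast_ne_zero.2 r.factorial_ne_zero
    have : ((Module.finrank ℝ V / 2 : ℕ) : ℂ) - 0 - r = m + 1 := by rw [hr]; push_cast; ring
    rw [this]
    push_cast
    field_simp

/-- Since `⋆Lⁿ = Λⁿ⋆`, the left side is `ΛⁿLⁿ1 / (n!)²`, and `ΛⁿLⁿ1 = (n!)²`. -/
theorem star_vol : h.star h.vol = oneForm := by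
  have hs : ∀ m η, h.star ((h.lefschetz ^ m) η) = (h.dualLefschetz ^ m) (h.star η) := by
    intro m
    induction m with
    | zero => intro η; rfl
    | succ m ih =>
      intro η
      rw [pow_succ', Module.End.mul_apply, star_lefschetz, ih, pow_succ', Module.End.mul_apply]
  conv_lhs => rw [vol_eq, map_smul, hs, star_oneForm, vol_eq, map_smul]
  rw [dualLefschetz_pow_lefschetz_pow h le_rfl, smul_smul, smul_smul]
  have hf : ((Module.finrank ℝ V / 2).factorial : ℂ) ≠ 0 :=
    Nat.cast_ne_zero.2 (Nat.factorial_ne_zero _)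
  rw [Nat.sub_self, pow_zero, Module.End.one_apply, Nat.factorial_zero, Nat.cast_one]
  convert one_smul ℂ (oneForm : Forms V)
  field_simp

theorem degree_vol : degree h.vol = (Module.finrank ℝ V : ℂ) • h.vol := by
  rw [vol_eq, map_smul, degree_lefschetz_pow h _ degree_oneForm, smul_comm]
  congr 2
  rw [← h.finrank_div_two]; ring

theorem wedgeCovectorLM_vol (θ : V →ₗ[ℝ] ℂ) : wedgeCovectorLM θ h.vol = 0 := by
  have hd : degree (wedgeCovectorLM θ h.vol) =
      ((Module.finrank ℝ V + 1 : ℕ) : ℂ) • wedgeCovectorLM θ h.vol := by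
    rw [degree_wedgeCovectorLM, degree_vol, map_smul]
    push_cast
    rw [add_smul, one_smul]
  funext k
  by_cases hk : k = Module.finrank ℝ V + 1
  · exact eq_zero_of_finrank_lt (by omega) _
  · exact apply_eq_zero_of_degree hd hk

/-- The companion of `star_wedgeCovectorLM`. On `1` both sides vanish, because nothing lies above
`vol`; the inductive step compares the two antiderivation rules, whose scalar terms `θ v` agree. -/
theorem star_contractLM (v : V) (η : Forms V) :
    h.star (contractLM v η) = -wedgeCovectorLM (h.flat v) (h.star (parity η)) := by
  refine h.forms_induction (p := fun η => h.star (contractLM v η) =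
      -wedgeCovectorLM (h.flat v) (h.star (parity η)))
    (fun η ζ h1 h2 => by simp only [map_add, h1, h2, neg_add])
    (fun c η h1 => by simp only [map_smul, h1, smul_neg]) ?_ (fun θ η h1 => ?_) η
  · rw [contractLM_oneForm, parity_oneForm, star_oneForm, wedgeCovectorLM_vol, map_zero, neg_zero]
  · rw [contractLM_wedgeCovectorLM, map_sub, map_smul, star_wedgeCovectorLM, parity_contractLM,
      map_neg, parity_wedgeCovectorLM, map_neg h.star (wedgeCovectorLM _ _), star_wedgeCovectorLM,
      parity_parity, map_neg]
    -- The inductive hypothesis concerns `η`, but the recursion calls for it at `parity η`;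
    -- conjugating by `parity` gives this.
    have h2 : h.star (contractLM v (parity η)) = -wedgeCovectorLM (h.flat v) (h.star η) := by
      have := congrArg parity h1
      rw [parity_star, parity_contractLM, map_neg, map_neg, parity_wedgeCovectorLM, neg_neg,
        parity_star, parity_parity, neg_eq_iff_eq_neg] at this
      exact this
    rw [h2, map_neg, contractCovector_wedgeCovectorLM, sum_frame_mul_flat]
    simp only [map_neg]
    abel

theorem star_star (η : Forms V) : h.star (h.star η) = parity η := by
  refine h.forms_induction (p := fun η => h.star (h.star η) = parity η)
    (fun η ζ h1 h2 => by simp only [map_add, h1, h2]) (fun c η h1 => by simp only [map_smul, h1])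
    ?_ (fun θ η h1 => ?_) η
  · rw [star_oneForm, star_vol, parity_oneForm]
  -- The rule for real vectors extends to complex covectors by linearity in `θ`.
  · have key : ∀ ζ, h.star (h.contractCovector θ ζ) = -wedgeCovectorLM θ (h.star (parity ζ)) := by
      intro ζ
      have e : θ = ∑ i, θ (h.frame i) • h.flat (h.frame i) := by
        ext v
        rw [← h.sum_frame_smul θ v]
        simp only [LinearMap.sum_apply, LinearMap.smul_apply, smul_eq_mul]
        exact Finset.sum_congr rfl fun i _ => mul_comm _ _
      conv_rhs => rw [e, ← wedgeCovectorHom_apply, map_sum]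
      rw [contractCovector_apply, map_sum, LinearMap.sum_apply, ← Finset.sum_neg_distrib]
      refine Finset.sum_congr rfl fun i _ => ?_
      rw [map_smul, star_contractLM, map_smul, LinearMap.smul_apply, wedgeCovectorHom_apply,
        smul_neg]
    rw [star_wedgeCovectorLM, key, parity_star, parity_parity, h1, parity_wedgeCovectorLM]

theorem starInv_eq (η : Forms V) : h.starInv η = parity (h.star η) := rfl

/-- `⋆⁻¹L⋆ = (-1)^k ⋆L⋆ = (-1)^k Λ⋆⋆`, and `⋆⋆ = (-1)^k`; the two signs cancel because `Λ` changes
the degree by two. -/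
theorem Lam_eq (η : Forms V) : h.Lam η = h.dualLefschetz η := by
  rw [Lam, L_eq, starInv_eq, hodgeStar_eq, star_lefschetz, star_star,
    parity_dualLefschetz, parity_parity]

end HermitianStructure

/-! ### Bidegree, and the Hodge star on forms of type `(0,q)` and `(1,q)` -/

namespace HermitianStructure

variable {V : Type*} [AddCommGroup V] [Module ℝ V] (h : HermitianStructure V)

theorem wedgeCovectorLM_mem_holo {θ : V →ₗ[ℝ] ℂ} (hθ : ∀ v, θ (h.J v) = Complex.I * θ v)
    {p q : ℕ} {η : Forms V} (hη : η ∈ h.typePQ (p, q)) :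
    wedgeCovectorLM θ η ∈ h.typePQ (p + 1, q) := by
  change η ∈ (h.typePQ (p + 1, q)).comap (wedgeCovectorLM θ)
  revert η
  change h.typePQ (p, q) ≤ _
  exact Submodule.span_le.2 fun η hη => Submodule.subset_span (IsProduct.holo θ hθ hη)

theorem wedgeCovectorLM_mem_anti {θ : V →ₗ[ℝ] ℂ} (hθ : ∀ v, θ (h.J v) = -Complex.I * θ v)
    {p q : ℕ} {η : Forms V} (hη : η ∈ h.typePQ (p, q)) :
    wedgeCovectorLM θ η ∈ h.typePQ (p, q + 1) := by
  change η ∈ (h.typePQ (p, q + 1)).comap (wedgeCovectorLM θ)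
  revert η
  change h.typePQ (p, q) ≤ _
  exact Submodule.span_le.2 fun η hη => Submodule.subset_span (IsProduct.anti θ hθ hη)

theorem parity_of_mem {p q : ℕ} {η : Forms V} (hη : η ∈ h.typePQ (p, q)) :
    parity η = (-1 : ℂ) ^ (p + q) • η := by
  suffices h.typePQ (p, q) ≤ LinearMap.eqLocus parity ((-1 : ℂ) ^ (p + q) • LinearMap.id) from
    this hη
  clear hη
  refine Submodule.span_le.2 fun η hη => ?_
  change parity η = (-1 : ℂ) ^ (p + q) • η
  change h.IsProduct p q η at hη
  induction hη with
  | one => simp [parity_oneForm]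
  | holo θ _ _ ih =>
    rw [← wedgeCovectorLM_apply, parity_wedgeCovectorLM, ih, map_smul, add_right_comm, pow_succ]
    simp
  | anti θ _ _ ih =>
    rw [← wedgeCovectorLM_apply, parity_wedgeCovectorLM, ih, map_smul, ← add_assoc, pow_succ]
    simp

theorem degree_of_mem {p q : ℕ} {η : Forms V} (hη : η ∈ h.typePQ (p, q)) :
    degree η = ((p + q : ℕ) : ℂ) • η := by
  suffices h.typePQ (p, q) ≤ LinearMap.eqLocus degree (((p + q : ℕ) : ℂ) • LinearMap.id) from
    this hη
  clear hη
  refine Submodule.span_le.2 fun η hη => ?_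
  change degree η = ((p + q : ℕ) : ℂ) • η
  change h.IsProduct p q η at hη
  induction hη with
  | one => simp [degree_oneForm]
  | holo θ _ _ ih =>
    rw [← wedgeCovectorLM_apply, degree_wedgeCovectorLM, ih, map_smul, add_right_comm,
      Nat.cast_succ, add_smul, one_smul]
  | anti θ _ _ ih =>
    rw [← wedgeCovectorLM_apply, degree_wedgeCovectorLM, ih, map_smul, ← add_assoc,
      Nat.cast_succ, add_smul, one_smul]

/-- Every `(1, q)`-form in a product presentation can be written with the `(1,0)`-covector first. -/
theorem IsProduct.exists_holo {p q : ℕ} {β : Forms V} (hβ : h.IsProduct p q β) (hp : p = 1) :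
    ∃ (ψ : V →ₗ[ℝ] ℂ) (η : Forms V), (∀ v, ψ (h.J v) = Complex.I * ψ v) ∧
      h.IsProduct 0 q η ∧ β = wedgeCovectorLM ψ η := by
  induction hβ with
  | one => omega
  | @holo p q η θ hθ hη _ =>
    obtain rfl : p = 0 := by omega
    exact ⟨θ, η, hθ, hη, rfl⟩
  | @anti p q β θ hθ hβ ih =>
    obtain ⟨ψ, η, hψ, hη, rfl⟩ := ih hp
    refine ⟨-ψ, wedgeCovectorLM θ η, fun v => by simp [hψ], hη.anti θ hθ, ?_⟩
    rw [← wedgeCovectorLM_apply, wedgeCovectorLM_anticomm, ← wedgeAt_apply _ (-ψ), map_neg,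
      wedgeAt_apply]

variable [FiniteDimensional ℝ V]

theorem component_of_mem {r : ℕ × ℕ} {η : Forms V} (hη : η ∈ h.typePQ r) :
    h.component r η = η :=
  Submodule.projection_apply_of_mem_left _ hη

theorem component_of_mem_ne {r s : ℕ × ℕ} {η : Forms V} (hη : η ∈ h.typePQ s) (hs : s ≠ r) :
    h.component r η = 0 :=
  (Submodule.projection_apply_eq_zero_iff _).2 (Submodule.mem_iSup_of_mem s
    (Submodule.mem_iSup_of_mem hs hη))

theorem component_mem (r : ℕ × ℕ) (η : Forms V) : h.component r η ∈ h.typePQ r :=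
  Submodule.projection_apply_mem _ _

/-- The form `ω` has type `(1,1)`: if `e_i = a + b` splits the frame covector into types `(1,0)` and
`(0,1)`, then `Je_i = -i a + i b`, so `e_i ∧ Je_i = 2i a ∧ b`. -/
theorem lefschetz_mem {p q : ℕ} {η : Forms V} (hη : η ∈ h.typePQ (p, q)) :
    h.lefschetz η ∈ h.typePQ (p + 1, q + 1) := by
  rw [lefschetz_apply]
  refine Submodule.smul_mem _ _ (Submodule.sum_mem _ fun i _ => ?_)
  set θ := h.flat (h.frame i) with hθ
  let a : V →ₗ[ℝ] ℂ := (1 / 2 : ℂ) • (θ - Complex.I • (θ ∘ₗ h.J))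
  let b : V →ₗ[ℝ] ℂ := (1 / 2 : ℂ) • (θ + Complex.I • (θ ∘ₗ h.J))
  have ha : ∀ v, a (h.J v) = Complex.I * a v := fun v => by
    simp [a, h.J_sq]
    linear_combination (1 / 2 * θ (h.J v)) * Complex.I_mul_I
  have hb : ∀ v, b (h.J v) = -Complex.I * b v := fun v => by
    simp [b, h.J_sq]
    linear_combination (1 / 2 * θ (h.J v)) * Complex.I_mul_I
  have e1 : θ = a + b := by ext v; simp [a, b]; ring
  have e2 : h.flat (h.J (h.frame i)) = -Complex.I • a + Complex.I • b := by
    ext v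
    have : h.flat (h.J (h.frame i)) v = -θ (h.J v) := by
      rw [hθ, flat_apply, flat_apply, g_J_left]; simp
    rw [this, e1]
    simp [ha, hb]
    ring
  have e3 : wedgeCovectorLM θ (wedgeCovectorLM (h.flat (h.J (h.frame i))) η) =
      (2 * Complex.I) • wedgeCovectorLM a (wedgeCovectorLM b η) := by
    rw [e2, e1]
    simp only [← wedgeCovectorHom_apply, map_add, map_smul, LinearMap.add_apply,
      LinearMap.smul_apply]
    simp only [wedgeCovectorHom_apply]
    rw [wedgeCovectorLM_self, wedgeCovectorLM_self, wedgeCovectorLM_anticomm b a]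
    module
  rw [e3]
  exact Submodule.smul_mem _ _
    (h.wedgeCovectorLM_mem_holo ha (h.wedgeCovectorLM_mem_anti hb hη))

theorem lefschetz_pow_mem (m : ℕ) {p q : ℕ} {η : Forms V} (hη : η ∈ h.typePQ (p, q)) :
    (h.lefschetz ^ m) η ∈ h.typePQ (p + m, q + m) := by
  induction m with
  | zero => exact hη
  | succ m ih =>
    rw [pow_succ', Module.End.mul_apply]
    exact h.lefschetz_mem ih

/-- `L` carries type `(a,b)` into type `(a+1,b+1)`, and this shift is injective on pairs, so the two
projections can be compared on each summand. -/
theorem component_lefschetz (p q : ℕ) (η : Forms V) :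
    h.component (p + 1, q + 1) (h.lefschetz η) = h.lefschetz (h.component (p, q) η) := by
  suffices (⊤ : Submodule ℂ (Forms V)) ≤ LinearMap.eqLocus
      (h.component (p + 1, q + 1) ∘ₗ h.lefschetz) (h.lefschetz ∘ₗ h.component (p, q)) from
    this (Submodule.mem_top (x := η))
  rw [← h.iSup_typePQ]
  refine iSup_le fun ⟨a, b⟩ η hη => ?_
  change h.component (p + 1, q + 1) (h.lefschetz η) = h.lefschetz (h.component (p, q) η)
  have hL := h.lefschetz_mem hη
  by_cases hr : (a, b) = (p, q)
  · rw [hr] at hη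
    obtain ⟨rfl, rfl⟩ := Prod.mk.inj hr
    rw [h.component_of_mem hη, h.component_of_mem hL]
  · rw [h.component_of_mem_ne hη hr, h.component_of_mem_ne hL, map_zero]
    intro hr'
    apply hr
    simpa using hr'

theorem component_lefschetz_pow (m p q : ℕ) (η : Forms V) :
    h.component (p + m, q + m) ((h.lefschetz ^ m) η) =
      (h.lefschetz ^ m) (h.component (p, q) η) := by
  induction m with
  | zero => rfl
  | succ m ih =>
    rw [pow_succ', Module.End.mul_apply, Module.End.mul_apply, ← ih]
    exact h.component_lefschetz _ _ _

/-- By isotropy, `ι_θ` anticommutes with every `(0,1)`-covector and can be moved through to `1`,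
which it kills. -/
theorem contractCovector_isProduct {θ : V →ₗ[ℝ] ℂ} (hθ : ∀ v, θ (h.J v) = -Complex.I * θ v)
    {p q : ℕ} {η : Forms V} (hη : h.IsProduct p q η) (hp : p = 0) :
    h.contractCovector θ η = 0 := by
  induction hη with
  | one => simp [contractCovector_apply, contractLM_oneForm]
  | holo => omega
  | anti φ hφ _ ih =>
    rw [← wedgeCovectorLM_apply, contractCovector_wedgeCovectorLM, h.sum_anti_mul_anti hθ hφ, ih hp]
    simp

theorem dualLefschetz_isProduct {p q : ℕ} {η : Forms V} (hη : h.IsProduct p q η) (hp : p = 0) :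
    h.dualLefschetz η = 0 := by
  induction hη with
  | one => exact h.dualLefschetz_oneForm
  | holo => omega
  | anti φ hφ hη ih =>
    rw [← wedgeCovectorLM_apply, h.dualLefschetz_wedgeCovectorLM hφ, ih hp,
      h.contractCovector_isProduct hφ hη hp]
    simp

/-- Forms of type `(0,q)` are primitive. -/
theorem dualLefschetz_of_mem {q : ℕ} {η : Forms V} (hη : η ∈ h.typePQ (0, q)) :
    h.dualLefschetz η = 0 := by
  suffices h.typePQ (0, q) ≤ LinearMap.ker h.dualLefschetz from this hη
  exact Submodule.span_le.2 fun η hη => h.dualLefschetz_isProduct hη rfl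

/-- Each passage of `ι_θ` across a factor `L` leaves `i θ ∧ ·`, which commutes with the remaining
factors. -/
theorem contractCovector_lefschetz_pow {θ : V →ₗ[ℝ] ℂ}
    (hθ : ∀ v, θ (h.J v) = -Complex.I * θ v) {η : Forms V} (hη : h.contractCovector θ η = 0)
    (m : ℕ) : h.contractCovector θ ((h.lefschetz ^ (m + 1)) η) =
      ((m + 1) * Complex.I : ℂ) • wedgeCovectorLM θ ((h.lefschetz ^ m) η) := by
  induction m with
  | zero => simp [h.contractCovector_lefschetz hθ, hη]
  | succ m ih =>
    have e : h.lefschetz ((h.lefschetz ^ m) η) = (h.lefschetz ^ (m + 1)) η := by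
      rw [pow_succ']; rfl
    rw [pow_succ', Module.End.mul_apply, h.contractCovector_lefschetz hθ, ih, map_smul,
      lefschetz_wedgeCovectorLM, e]
    push_cast
    module

/-- The coefficient in `⋆α = c_q L^{n-q} α / (n-q)!` for `α` of type `(0,q)`. -/
def starCoeff : ℕ → ℂ
  | 0 => 1
  | q + 1 => (-1) ^ q * Complex.I * starCoeff q

/-- Induction on `q`, with `m` growing as covectors are removed: `⋆(φ ∧ η) = (-1)^q ι_φ ⋆η`, and
`ι_φ L^(m+1) η = (m+1) i φ ∧ L^m η`. The factor `m + 1` lowers the factorial, while `(-1)^q i` is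
the recursion of `starCoeff`. -/
theorem star_isProduct {p q : ℕ} {η : Forms V} (hη : h.IsProduct p q η) (hp : p = 0)
    (m : ℕ) (hm : Module.finrank ℝ V / 2 = q + m) :
    h.star η = (starCoeff q / m.factorial) • (h.lefschetz ^ m) η := by
  induction hη generalizing m with
  | one =>
    obtain rfl : m = Module.finrank ℝ V / 2 := by omega
    rw [star_oneForm, vol_eq, starCoeff]
  | holo => omega
  | @anti p q η φ hφ hη ih =>
    obtain rfl := hp
    rw [← wedgeCovectorLM_apply, star_wedgeCovectorLM, lefschetz_pow_wedgeCovectorLM,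
      h.parity_of_mem (Submodule.subset_span hη), map_smul, map_smul,
      ih rfl (m + 1) (by omega), map_smul,
      h.contractCovector_lefschetz_pow hφ (h.contractCovector_isProduct hφ hη rfl), smul_smul,
      smul_smul]
    congr 1
    rw [starCoeff, Nat.factorial_succ]
    have hf : (m.factorial : ℂ) ≠ 0 := Nat.cast_ne_zero.2 m.factorial_ne_zero
    have hm1 : (m : ℂ) + 1 ≠ 0 := Nat.cast_add_one_ne_zero m
    push_cast
    field_simp
    simp
    ring

theorem star_of_mem {q : ℕ} {η : Forms V} (hη : η ∈ h.typePQ (0, q))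
    (m : ℕ) (hm : Module.finrank ℝ V / 2 = q + m) :
    h.star η = (starCoeff q / m.factorial) • (h.lefschetz ^ m) η := by
  suffices h.typePQ (0, q) ≤ LinearMap.eqLocus h.star
    ((starCoeff q / m.factorial) • (h.lefschetz ^ m)) from this hη
  exact Submodule.span_le.2 fun η hη => h.star_isProduct hη rfl m hm

/-- At `q = n` the form `⋆η` is a multiple of `η` itself, so `⋆(φ ∧ η)` is a multiple of `ι_φ η =
0`, and `⋆` is injective. -/
theorem isProduct_eq_zero {p q : ℕ} {η : Forms V} (hη : h.IsProduct p q η) (hp : p = 0)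
    (hq : Module.finrank ℝ V / 2 < q) : η = 0 := by
  induction hη with
  | one => omega
  | holo => omega
  | @anti p q η φ hφ hη ih =>
    obtain rfl := hp
    rcases Nat.lt_or_ge (Module.finrank ℝ V / 2) q with hlt | hge
    · rw [ih rfl hlt, ← wedgeCovectorLM_apply, map_zero]
    · have hs : h.star (wedgeCovectorLM φ η) = 0 := by
        rw [star_wedgeCovectorLM, h.parity_of_mem (Submodule.subset_span hη), map_smul, map_smul,
          h.star_isProduct hη rfl 0 (by omega), map_smul, pow_zero, Module.End.one_apply,
          h.contractCovector_isProduct hφ hη rfl, smul_zero, smul_zero]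
      have hss := h.star_star (wedgeCovectorLM φ η)
      rw [hs, map_zero] at hss
      rw [← wedgeCovectorLM_apply, ← parity_parity (wedgeCovectorLM φ η), ← hss, map_zero]

theorem eq_zero_of_mem {q : ℕ} {η : Forms V} (hη : η ∈ h.typePQ (0, q))
    (hq : Module.finrank ℝ V / 2 < q) : η = 0 := by
  suffices h.typePQ (0, q) ≤ ⊥ from this hη
  exact Submodule.span_le.2 fun η hη => h.isProduct_eq_zero hη rfl hq

/-- On forms of type `(1,q)`, `Λ = -i c_q ⋆ L^{n-q} / (n-q)!`. -/
theorem dualLefschetz_of_mem_one {q : ℕ} {β : Forms V} (hβ : β ∈ h.typePQ (1, q))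
    (m : ℕ) (hm : Module.finrank ℝ V / 2 = q + m) :
    h.dualLefschetz β =
      (-Complex.I * starCoeff q / m.factorial) • h.star ((h.lefschetz ^ m) β) := by
  suffices h.typePQ (1, q) ≤ LinearMap.eqLocus h.dualLefschetz
    ((-Complex.I * starCoeff q / m.factorial) • (h.star ∘ₗ (h.lefschetz ^ m))) from this hβ
  refine Submodule.span_le.2 fun β hβ => ?_
  change h.dualLefschetz β =
      (-Complex.I * starCoeff q / m.factorial) • h.star ((h.lefschetz ^ m) β)
  obtain ⟨ψ, η, hψ, hη, rfl⟩ := IsProduct.exists_holo h hβ rfl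
  have hmem : η ∈ h.typePQ (0, q) := Submodule.subset_span hη
  -- Applying `⋆` to `⋆η = c L^m η` recovers `η` as `c ⋆ L^m (-1)^q η`. Then `Λ(ψ ∧ η) = -i ι_ψ η`,
  -- and `ι_ψ` is absorbed into `⋆` by the recursion.
  have hss := h.star_star η
  rw [h.star_of_mem hmem m hm, map_smul, h.parity_of_mem hmem, zero_add] at hss
  have hη' : (starCoeff q / m.factorial) • h.star ((h.lefschetz ^ m) (parity η)) = η := by
    rw [h.parity_of_mem hmem, zero_add, map_smul, map_smul, smul_comm, hss, smul_smul, ← mul_pow]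
    simp
  rw [h.dualLefschetz_wedgeCovectorLM hψ, h.dualLefschetz_of_mem hmem,
    lefschetz_pow_wedgeCovectorLM, star_wedgeCovectorLM, parity_lefschetz_pow,
    mul_div_assoc, mul_smul, ← map_smul (h.contractCovector ψ) (starCoeff q / _), hη',
    map_zero, zero_sub, neg_smul]

theorem dualLefschetz_lefschetz_of_mem {q : ℕ} {η : Forms V} (hη : η ∈ h.typePQ (0, q))
    (m : ℕ) (hm : Module.finrank ℝ V / 2 = q + m) :
    h.dualLefschetz (h.lefschetz η) = (m : ℂ) • η := by
  rw [dualLefschetz_lefschetz, h.dualLefschetz_of_mem hη, h.degree_of_mem hη, h.finrank_div_two,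
    hm, ← sub_smul]
  simp

theorem star_lefschetz_of_mem {q : ℕ} {η : Forms V} (hη : η ∈ h.typePQ (0, q))
    (m : ℕ) (hm : Module.finrank ℝ V / 2 = q + m) :
    h.star (h.lefschetz η) = (starCoeff q / m.factorial * m) • (h.lefschetz ^ (m - 1)) η := by
  rw [star_lefschetz, h.star_of_mem hη m hm, map_smul, mul_smul]
  congr 1
  cases m with
  | zero => simp [h.dualLefschetz_of_mem hη]
  | succ m =>
    rw [h.dualLefschetz_lefschetz_pow m (h.degree_of_mem hη) (h.dualLefschetz_of_mem hη), hm]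
    congr 1
    push_cast; ring

/-- The linear algebra behind the commutator identity: `X` and `Y` play the role of the `(2,q+1)`
part of `dω ∧ α` and of `∂α`. -/
theorem dualLefschetz_eq_commutator {q : ℕ} (X : Forms V) {Y : Forms V} (hY : Y ∈ h.typePQ (1, q))
    (m : ℕ) (hm : Module.finrank ℝ V / 2 = q + m) :
    let D : ℕ → Forms V := fun j => (j : ℂ) • (h.lefschetz ^ (j - 1)) X + (h.lefschetz ^ j) Y
    let c := starCoeff q / m.factorial
    h.dualLefschetz Y = Complex.I • -h.star (c • D m) + Complex.I •
      (h.dualLefschetz (-h.star ((c * m) • D (m - 1))) - -h.star ((c * m) • D m)) := by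
  intro D c
  have hL : ∀ ζ, h.dualLefschetz (-h.star ζ) = -h.star (h.lefschetz ζ) := fun ζ => by
    rw [map_neg, star_lefschetz]
  -- All terms are brought under a single `⋆`, leaving an identity between `L^(m-1) X` and `L^m Y`.
  -- For `m = 0` the truncated exponent `m - 1` is harmless, since its terms carry a factor `m`.
  rw [h.dualLefschetz_of_mem_one hY m hm, hL, ← map_neg, ← map_neg, sub_neg_eq_add, ← map_add,
    ← map_smul h.star, ← map_smul h.star, ← map_smul h.star, ← map_add]
  congr 1
  rw [mul_div_assoc]
  change (-Complex.I * c) • _ = _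
  cases m with
  | zero => simp [D, mul_smul]
  | succ m =>
    have hpow : (m : ℂ) • h.lefschetz ((h.lefschetz ^ (m - 1)) X) =
        (m : ℂ) • (h.lefschetz ^ m) X := by
      cases m with
      | zero => simp
      | succ m => rw [pow_succ']; rfl
    simp only [D, Nat.add_sub_cancel, map_smul, map_add, hpow]
    rw [← Module.End.mul_apply, ← pow_succ']
    push_cast
    module

end HermitianStructure

/-! ### Coordinates on a vector space: pullback and the Leibniz rule for `d(Ω ∧ A)` -/

open HermitianStructure

section Pullback

variable {V W : Type*} [AddCommGroup V] [Module ℝ V] [AddCommGroup W] [Module ℝ W]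

/-- Pullback of forms along a linear map. -/
def pullbackLM (A : W →ₗ[ℝ] V) : Forms V →ₗ[ℂ] Forms W where
  toFun η := fun k => (η k).compLinearMap A
  map_add' _ _ := rfl
  map_smul' _ _ := rfl

theorem pullbackLM_apply (A : W →ₗ[ℝ] V) (η : Forms V) (k : ℕ) :
    pullbackLM A η k = (η k).compLinearMap A := rfl

theorem pullbackLM_wedgeTwoForm (A : W →ₗ[ℝ] V) (σ : V [⋀^Fin 2]→ₗ[ℝ] ℝ) (η : Forms V) :
    pullbackLM A (wedgeTwoForm σ η) = wedgeTwoForm (σ.compLinearMap A) (pullbackLM A η) := by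
  funext k
  match k with
  | 0 => ext v; simp [pullbackLM_apply, wedgeTwoForm]
  | 1 => ext v; simp [pullbackLM_apply, wedgeTwoForm]
  | k + 2 =>
    ext v
    simp only [pullbackLM_apply, wedgeTwoForm, AlternatingMap.compLinearMap_apply,
      AlternatingMap.smul_apply, AlternatingMap.alternatizeUncurryFin_apply, LinearMap.comp_apply,
      AlternatingMap.alternatizeUncurryFinLM_apply, LinearMap.mk₂_apply]
    congr 1
    refine Finset.sum_congr rfl fun i _ => ?_
    congr 1
    refine Finset.sum_congr rfl fun j _ => ?_
    congr 2
    congr 1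
    funext a
    refine Fin.cases ?_ (fun a => ?_) a
    · rfl
    · obtain rfl := Fin.fin_one_eq_zero a
      rfl

/-- Evaluation of forms on tuples of vectors. -/
def evalForms (k : ℕ) (v : Fin k → V) : Forms V →ₗ[ℂ] ℂ where
  toFun η := η k v
  map_add' _ _ := rfl
  map_smul' _ _ := rfl

theorem forms_sum_apply {ι : Type*} (s : Finset ι) (f : ι → Forms V) (k : ℕ) (v : Fin k → V) :
    (∑ i ∈ s, f i) k v = ∑ i ∈ s, f i k v :=
  map_sum (evalForms k v) f s

end Pullback

section Basis

variable {V : Type*} [AddCommGroup V] [Module ℝ V] {ι : Type*} [Fintype ι]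
  (b : Module.Basis ι ℝ V)

/-- Wedge product with the real coordinate covector `b^i`. -/
def wedgeCoord (i : ι) : Module.End ℂ (Forms V) := wedgeCovectorLM (complexify (b.coord i))

/-- Separates the scalar coefficients of `σ` from operators independent of `σ`, so that
differentiating a wedge product becomes the product rule for scalars times vectors. -/
theorem wedgeTwoForm_eq_sum_coord (σ : V [⋀^Fin 2]→ₗ[ℝ] ℝ) (η : Forms V) :
    wedgeTwoForm σ η = ∑ i, ∑ j, (σ ![b i, b j] / 2) • wedgeCoord b i (wedgeCoord b j η) := by
  rw [wedgeTwoForm_eq_sum b, Finset.smul_sum]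
  refine Finset.sum_congr rfl fun i _ => ?_
  have e : contractTwoForm σ (b i) = ∑ j, (σ ![b i, b j] : ℂ) • complexify (b.coord j) := by
    classical
    refine b.ext fun l => ?_
    rw [LinearMap.sum_apply, Finset.sum_eq_single l]
    · simp [contractTwoForm_apply, complexify_apply]
    · intro j _ hj
      simp [complexify_apply, hj.symm]
    · simp
  rw [e, ← wedgeCovectorHom_apply (∑ j, _), map_sum, LinearMap.sum_apply, map_sum, Finset.smul_sum]
  refine Finset.sum_congr rfl fun j _ => ?_
  rw [map_smul, LinearMap.smul_apply, map_smul, smul_smul, wedgeCovectorHom_apply,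
    ← IsScalarTower.algebraMap_smul ℂ (σ ![b i, b j] / 2)]
  congr 1
  simp
  ring

theorem wedgeTwoForm_wedgeCoord (σ : V [⋀^Fin 2]→ₗ[ℝ] ℝ) (l : ι) (η : Forms V) :
    wedgeTwoForm σ (wedgeCoord b l η) = wedgeCoord b l (wedgeTwoForm σ η) := by
  rw [wedgeTwoForm_eq_sum b, wedgeTwoForm_eq_sum b, map_smul, map_sum]
  congr 1
  refine Finset.sum_congr rfl fun i _ => ?_
  rw [wedgeCoord, wedgeCovectorLM_anticomm _ (complexify (b.coord l)), map_neg,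
    wedgeCovectorLM_anticomm _ (complexify (b.coord l)), neg_neg]

/-- Wedge product with a real `2`-form as a complex linear map. -/
def wedgeTwoFormLM (σ : V [⋀^Fin 2]→ₗ[ℝ] ℝ) : Module.End ℂ (Forms V) :=
  ∑ i, ∑ j, ((σ ![b i, b j] / 2 : ℝ) : ℂ) • (wedgeCoord b i * wedgeCoord b j)

theorem wedgeTwoFormLM_apply (σ : V [⋀^Fin 2]→ₗ[ℝ] ℝ) (η : Forms V) :
    wedgeTwoFormLM b σ η = wedgeTwoForm σ η := by
  rw [wedgeTwoForm_eq_sum_coord b]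
  simp only [wedgeTwoFormLM, LinearMap.sum_apply, LinearMap.smul_apply, Module.End.mul_apply]
  exact Finset.sum_congr rfl fun i _ => Finset.sum_congr rfl fun j _ =>
    IsScalarTower.algebraMap_smul ℂ (σ ![b i, b j] / 2) _

end Basis

section Derivative

variable {E : Type*} [NormedAddCommGroup E] [NormedSpace ℝ E]

/-- The form at `y` of a family of differential forms on `E`. -/
def formAt (A : ∀ k, E → E [⋀^Fin k]→L[ℝ] ℂ) (y : E) : Forms E :=
  fun k => (A k y).toAlternatingMap

/-- The derivative at `y` in the direction `v` of a family of differential forms on `E`. -/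
def fderivForms (A : ∀ k, E → E [⋀^Fin k]→L[ℝ] ℂ) (y v : E) : Forms E :=
  fun k => (fderiv ℝ (A k) y v).toAlternatingMap

/-- The exterior derivative of a family of differential forms on `E`. -/
def extDerivForms (A : ∀ k, E → E [⋀^Fin k]→L[ℝ] ℂ) (y : E) : Forms E
  | 0 => 0
  | k + 1 => (extDeriv (A k) y).toAlternatingMap

/-- The classical `d = ∑ dx^l ∧ ∂_l`, which makes `d` accessible to the covector algebra. -/
theorem extDerivForms_eq_sum {ι : Type*} [Fintype ι] (b : Module.Basis ι ℝ E)
    (A : ∀ k, E → E [⋀^Fin k]→L[ℝ] ℂ) (y : E) :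
    extDerivForms A y = ∑ l, wedgeCoord b l (fderivForms A y (b l)) := by
  funext k
  cases k with
  | zero => simp [extDerivForms, wedgeCoord, wedgeCovectorLM_zero_apply]
  | succ k =>
    simp only [extDerivForms, Finset.sum_apply, wedgeCoord, wedgeCovectorLM_succ_apply, extDeriv,
      ContinuousAlternatingMap.toAlternatingMap_alternatizeUncurryFin]
    simp_rw [← AlternatingMap.alternatizeUncurryFinLM_apply]
    rw [← map_sum]
    congr 1
    refine b.ext fun i => ?_
    classical
    rw [LinearMap.sum_apply, Finset.sum_eq_single i]
    · ext v
      simp [complexify_apply, fderivForms]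
    · intro l _ hl
      ext v
      simp [complexify_apply, hl.symm]
    · simp

variable [FiniteDimensional ℝ E]

theorem toAlternatingMap_toContinuous {k : ℕ} (f : E [⋀^Fin k]→ₗ[ℝ] ℂ) :
    (toContinuous f).toAlternatingMap = f := rfl

/-- Wedge product with a coordinate covector on continuous alternating maps. -/
def wedgeCoordCLM {ι : Type*} [Fintype ι] (b : Module.Basis ι ℝ E) (i : ι) (k : ℕ) :
    (E [⋀^Fin k]→L[ℝ] ℂ) →L[ℝ] E [⋀^Fin (k + 1)]→L[ℝ] ℂ :=
  (ContinuousAlternatingMap.alternatizeUncurryFinCLM ℝ E ℂ) ∘L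
    (ContinuousLinearMap.smulRightL ℝ E (E [⋀^Fin k]→L[ℝ] ℂ)
      (LinearMap.toContinuousLinearMap (b.coord i)))

theorem toAlternatingMap_wedgeCoordCLM {ι : Type*} [Fintype ι] (b : Module.Basis ι ℝ E) (i : ι)
    (k : ℕ) (f : E [⋀^Fin k]→L[ℝ] ℂ) (η : Forms E) (hη : η k = f.toAlternatingMap) :
    (wedgeCoordCLM b i k f).toAlternatingMap = wedgeCoord b i η (k + 1) := by
  rw [wedgeCoord, wedgeCovectorLM_succ_apply, hη]
  change (ContinuousAlternatingMap.alternatizeUncurryFin _).toAlternatingMap = _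
  rw [ContinuousAlternatingMap.toAlternatingMap_alternatizeUncurryFin]
  congr 1

/-- Wedge product of a family of differential forms on `E` with a family of `2`-forms. -/
def wedgeFamily (Ω : E → E [⋀^Fin 2]→ₗ[ℝ] ℝ) (A : ∀ k, E → E [⋀^Fin k]→L[ℝ] ℂ) (k : ℕ) (y : E) :
    E [⋀^Fin k]→L[ℝ] ℂ :=
  toContinuous (wedgeTwoForm (Ω y) (formAt A y) k)

theorem wedgeFamily_eq_sum {ι : Type*} [Fintype ι] (b : Module.Basis ι ℝ E)
    (Ω : E → E [⋀^Fin 2]→ₗ[ℝ] ℝ) (A : ∀ k, E → E [⋀^Fin k]→L[ℝ] ℂ) (k : ℕ) :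
    wedgeFamily Ω A (k + 2) = fun y => ∑ i, ∑ j, (Ω y ![b i, b j] / 2) •
      wedgeCoordCLM b i (k + 1) (wedgeCoordCLM b j k (A k y)) := by
  funext y
  apply ContinuousAlternatingMap.toAlternatingMap_injective
  rw [wedgeFamily, toAlternatingMap_toContinuous, wedgeTwoForm_eq_sum_coord b]
  ext v
  simp only [forms_sum_apply, Pi.smul_apply]
  have key : ∀ i j, wedgeCoord b i (wedgeCoord b j (formAt A y)) (k + 2) =
      (wedgeCoordCLM b i (k + 1) (wedgeCoordCLM b j k (A k y))).toAlternatingMap := fun i j => by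
    rw [toAlternatingMap_wedgeCoordCLM b i (k + 1) _ (wedgeCoord b j (formAt A y))]
    rw [toAlternatingMap_wedgeCoordCLM b j k _ (formAt A y) rfl]
  simp_rw [key]
  simp

variable {Ω : E → E [⋀^Fin 2]→ₗ[ℝ] ℝ} {A : ∀ k, E → E [⋀^Fin k]→L[ℝ] ℂ} {y : E}

theorem hasFDerivAt_wedgeFamily {ι : Type*} [Fintype ι] (b : Module.Basis ι ℝ E)
    (hΩ : ∀ u w, DifferentiableAt ℝ (fun z => Ω z ![u, w]) y)
    (hA : ∀ k, DifferentiableAt ℝ (A k) y) (k : ℕ) :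
    HasFDerivAt (wedgeFamily Ω A (k + 2)) (∑ i, ∑ j,
      ((Ω y ![b i, b j] / 2) • (wedgeCoordCLM b i (k + 1) ∘L wedgeCoordCLM b j k ∘L
          fderiv ℝ (A k) y) +
        ((2 : ℝ)⁻¹ • fderiv ℝ (fun z => Ω z ![b i, b j]) y).smulRight
          (wedgeCoordCLM b i (k + 1) (wedgeCoordCLM b j k (A k y))))) y := by
  rw [wedgeFamily_eq_sum b]
  refine HasFDerivAt.fun_sum fun i _ => HasFDerivAt.fun_sum fun j _ => ?_
  refine HasFDerivAt.fun_smul (c := fun z => Ω z ![b i, b j] / 2)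
    (f := fun z => wedgeCoordCLM b i (k + 1) (wedgeCoordCLM b j k (A k z)))
    (c' := (2 : ℝ)⁻¹ • fderiv ℝ (fun z => Ω z ![b i, b j]) y) ?_ ?_
  · simp only [div_eq_mul_inv]
    exact (hΩ _ _).hasFDerivAt.mul_const _
  · exact ((wedgeCoordCLM b i (k + 1)).hasFDerivAt.comp y
      ((wedgeCoordCLM b j k).hasFDerivAt.comp y (hA k).hasFDerivAt))

theorem differentiableAt_wedgeFamily
    (hΩ : ∀ u w, DifferentiableAt ℝ (fun z => Ω z ![u, w]) y)
    (hA : ∀ k, DifferentiableAt ℝ (A k) y) (k : ℕ) :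
    DifferentiableAt ℝ (wedgeFamily Ω A k) y := by
  match k with
  | 0 => exact differentiableAt_const (toContinuous 0)
  | 1 => exact differentiableAt_const (toContinuous 0)
  | k + 2 => exact (hasFDerivAt_wedgeFamily (Module.finBasis ℝ E) hΩ hA k).differentiableAt

theorem fderivForms_wedgeFamily {ι : Type*} [Fintype ι] (b : Module.Basis ι ℝ E)
    (hΩ : ∀ u w, DifferentiableAt ℝ (fun z => Ω z ![u, w]) y)
    (hA : ∀ k, DifferentiableAt ℝ (A k) y) (v : E) :
    fderivForms (wedgeFamily Ω A) y v = wedgeTwoForm (Ω y) (fderivForms A y v) +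
      ∑ i, ∑ j, (2⁻¹ * fderiv ℝ (fun z => Ω z ![b i, b j]) y v) •
        wedgeCoord b i (wedgeCoord b j (formAt A y)) := by
  funext k
  rw [wedgeTwoForm_eq_sum_coord b]
  match k with
  | 0 =>
    have : fderiv ℝ (wedgeFamily Ω A 0) y = 0 := fderiv_const_apply (toContinuous 0)
    ext w
    rw [Pi.add_apply, AlternatingMap.add_apply]
    simp only [forms_sum_apply, Pi.smul_apply]
    simp [fderivForms, this, wedgeCoord, wedgeCovectorLM_zero_apply]
  | 1 =>
    have : fderiv ℝ (wedgeFamily Ω A 1) y = 0 := fderiv_const_apply (toContinuous 0)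
    ext w
    rw [Pi.add_apply, AlternatingMap.add_apply]
    simp only [forms_sum_apply, Pi.smul_apply]
    simp [fderivForms, this, wedgeCoord, wedgeCovectorLM_zero_apply, wedgeCovectorLM_succ_apply,
      AlternatingMap.alternatizeUncurryFin_apply]
  | k + 2 =>
    have key : ∀ i j (f : E [⋀^Fin k]→L[ℝ] ℂ) (η : Forms E), η k = f.toAlternatingMap →
        wedgeCoord b i (wedgeCoord b j η) (k + 2) =
        (wedgeCoordCLM b i (k + 1) (wedgeCoordCLM b j k f)).toAlternatingMap := fun i j f η hη => by
      rw [toAlternatingMap_wedgeCoordCLM b i (k + 1) _ (wedgeCoord b j η)]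
      rw [toAlternatingMap_wedgeCoordCLM b j k _ η hη]
    rw [fderivForms, (hasFDerivAt_wedgeFamily b hΩ hA k).fderiv]
    ext w
    rw [Pi.add_apply, AlternatingMap.add_apply]
    simp only [forms_sum_apply, Pi.smul_apply]
    simp_rw [fun i j => key i j (fderiv ℝ (A k) y v) (fderivForms A y v) rfl,
      fun i j => key i j (A k y) (formAt A y) rfl]
    simp [Finset.sum_add_distrib]

variable (Ω y) in
/-- Wedge product with the exterior derivative of a family of `2`-forms. -/
def wedgeExtDeriv : Module.End ℂ (Forms E) :=
  let b := Module.finBasis ℝ E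
  ∑ l, ∑ i, ∑ j, ((2⁻¹ * fderiv ℝ (fun z => Ω z ![b i, b j]) y (b l) : ℝ) : ℂ) •
    (wedgeCoord b l * wedgeCoord b i * wedgeCoord b j)

/-- A 2-form commutes with each coordinate covector, hence with `dΩ ∧ ·`. This lets `dω` be moved
past powers of `L`. -/
theorem wedgeExtDeriv_wedgeTwoForm (σ : E [⋀^Fin 2]→ₗ[ℝ] ℝ) (η : Forms E) :
    wedgeExtDeriv Ω y (wedgeTwoForm σ η) = wedgeTwoForm σ (wedgeExtDeriv Ω y η) := by
  rw [← wedgeTwoFormLM_apply (Module.finBasis ℝ E) σ (wedgeExtDeriv Ω y η)]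
  simp only [wedgeExtDeriv, LinearMap.sum_apply, map_sum, LinearMap.smul_apply, map_smul,
    Module.End.mul_apply, wedgeTwoFormLM_apply, wedgeTwoForm_wedgeCoord]

theorem extDerivForms_wedgeFamily
    (hΩ : ∀ u w, DifferentiableAt ℝ (fun z => Ω z ![u, w]) y)
    (hA : ∀ k, DifferentiableAt ℝ (A k) y) :
    extDerivForms (wedgeFamily Ω A) y =
      wedgeExtDeriv Ω y (formAt A y) + wedgeTwoForm (Ω y) (extDerivForms A y) := by
  set b := Module.finBasis ℝ E with hb
  rw [extDerivForms_eq_sum b, extDerivForms_eq_sum b A, ← wedgeTwoFormLM_apply b]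
  simp only [fderivForms_wedgeFamily b hΩ hA, map_add, map_sum, wedgeTwoFormLM_apply,
    wedgeTwoForm_wedgeCoord, Finset.sum_add_distrib]
  rw [add_comm, wedgeExtDeriv]
  congr 1
  simp only [LinearMap.sum_apply, LinearMap.smul_apply, Module.End.mul_apply]
  refine Finset.sum_congr rfl fun l _ => Finset.sum_congr rfl fun i _ =>
    Finset.sum_congr rfl fun j _ => ?_
  rw [← IsScalarTower.algebraMap_smul ℂ (2⁻¹ * _ : ℝ), map_smul]
  rfl

end Derivative

/-! ### The exterior derivative on the manifold, and `∂` on powers of `L` -/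

open HermitianStructure

section ExteriorDerivative

variable {E : Type*} [NormedAddCommGroup E] [NormedSpace ℝ E] [FiniteDimensional ℝ E]
variable {M : Type*} [TopologicalSpace M] [ChartedSpace E M]

/-- Differentiability at `x` of a field of forms, in the chart around `x`. -/
def DifferentiableInChart (α : FormField E M) (x : M) : Prop :=
  ∀ k, DifferentiableAt ℝ (inChart α x k) (extChartAt 𝓘(ℝ, E) x x)

theorem IsSmooth.differentiableInChart {α : FormField E M} (hα : IsSmooth α) (x : M) :
    DifferentiableInChart α x := fun k =>
  ((hα x k).contDiffAt (extChartAt_target_mem_nhds x)).differentiableAt (by simp)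

/-- The derivative at `x` of the chart around `x`. -/
def chartDeriv (x : M) : TangentSpace 𝓘(ℝ, E) x →ₗ[ℝ] E :=
  (mfderiv 𝓘(ℝ, E) 𝓘(ℝ, E) (extChartAt 𝓘(ℝ, E) x) x).toLinearMap

theorem d_eq (α : FormField E M) (x : M) :
    d α x = pullbackLM (chartDeriv x)
      (extDerivForms (inChart α x) (extChartAt 𝓘(ℝ, E) x x)) := by
  funext k
  cases k with
  | zero => rfl
  | succ k => rfl

theorem DifferentiableInChart.smul {α : FormField E M} {x : M} (hα : DifferentiableInChart α x)
    (c : ℂ) : DifferentiableInChart (c • α) x := fun k => (hα k).const_smul c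

theorem d_smul {α : FormField E M} {x : M} (hα : DifferentiableInChart α x) (c : ℂ) :
    d (c • α) x = c • d α x := by
  rw [d_eq, d_eq, extDerivForms_eq_sum (Module.finBasis ℝ E),
    extDerivForms_eq_sum (Module.finBasis ℝ E), ← map_smul, Finset.smul_sum]
  congr 1
  refine Finset.sum_congr rfl fun l _ => ?_
  rw [← map_smul]
  congr 1
  funext k
  change (fderiv ℝ (c • inChart α x k) _ _).toAlternatingMap = _
  rw [fderiv_const_smul (hα k) c]
  rfl

theorem d_zero : d (0 : FormField E M) = 0 := by
  funext x
  have h0 : DifferentiableInChart (0 : FormField E M) x := fun k =>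
    differentiableAt_const (toContinuous 0)
  have := d_smul h0 0
  rwa [smul_zero, zero_smul] at this

end ExteriorDerivative

namespace AlmostHermitianStructure

variable {E : Type*} [NormedAddCommGroup E] [NormedSpace ℝ E]
variable {M : Type*} [TopologicalSpace M] [ChartedSpace E M] [IsManifold 𝓘(ℝ, E) ∞ M]

/-- Coordinate vector fields are smooth: they arise from the tangent map of the inverse chart
applied to a constant section. -/
theorem contMDiffAt_mfderiv_extChartAt_symm (x : M) (u : E) :
    ContMDiffAt 𝓘(ℝ, E) (𝓘(ℝ, E).prod 𝓘(ℝ, E)) ∞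
      (fun y : E => (TotalSpace.mk' E ((extChartAt 𝓘(ℝ, E) x).symm y)
        (mfderiv 𝓘(ℝ, E) 𝓘(ℝ, E) (extChartAt 𝓘(ℝ, E) x).symm y u) :
          TangentBundle 𝓘(ℝ, E) M)) (extChartAt 𝓘(ℝ, E) x x) := by
  have hopen : IsOpen (extChartAt 𝓘(ℝ, E) x).target := isOpen_extChartAt_target x
  have hmem := mem_extChartAt_target (I := 𝓘(ℝ, E)) x
  have h1 := (contMDiffOn_extChartAt_symm (I := 𝓘(ℝ, E)) (n := ∞) x).contMDiffOn_tangentMapWithin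
    (m := ∞) (by simp) hopen.uniqueMDiffOn
  have h2 : ContMDiffAt 𝓘(ℝ, E) (𝓘(ℝ, E).prod 𝓘(ℝ, E)) ∞
      (fun y : E => (TotalSpace.mk' E y u : TangentBundle 𝓘(ℝ, E) E))
      (extChartAt 𝓘(ℝ, E) x x) :=
    contMDiffAt_vectorSpace_iff_contDiffAt.2 contDiffAt_const
  have h3 := ContMDiffAt.comp (extChartAt 𝓘(ℝ, E) x x) ((h1 ⟨extChartAt 𝓘(ℝ, E) x x, u⟩
    hmem).contMDiffAt ((hopen.preimage (FiberBundle.continuous_proj E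
      (TangentSpace 𝓘(ℝ, E)))).mem_nhds hmem)) h2
  refine h3.congr_of_eventuallyEq ?_
  filter_upwards [hopen.mem_nhds hmem] with y hy
  simp only [Function.comp, tangentMapWithin, mfderivWithin_of_isOpen hopen hy]

variable (H : AlmostHermitianStructure E M)

/-- The fundamental form in the chart around `x`. -/
def omegaInChart (x : M) (y : E) : E [⋀^Fin 2]→ₗ[ℝ] ℝ :=
  (H.tangent ((extChartAt 𝓘(ℝ, E) x).symm y)).omega.compLinearMap
    (mfderiv 𝓘(ℝ, E) 𝓘(ℝ, E) (extChartAt 𝓘(ℝ, E) x).symm y).toLinearMap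

theorem differentiableAt_omegaInChart (x : M) (u w : E) :
    DifferentiableAt ℝ (fun y => H.omegaInChart x y ![u, w]) (extChartAt 𝓘(ℝ, E) x x) := by
  have hmem := mem_extChartAt_target (I := 𝓘(ℝ, E)) x
  have hs : ContMDiffAt 𝓘(ℝ, E) 𝓘(ℝ, E) ∞ (extChartAt 𝓘(ℝ, E) x).symm
      (extChartAt 𝓘(ℝ, E) x x) :=
    (contMDiffOn_extChartAt_symm (I := 𝓘(ℝ, E)) (n := ∞) x).contMDiffAt
      ((isOpen_extChartAt_target x).mem_nhds hmem)
  have hJ : ContMDiffAt 𝓘(ℝ, E) (𝓘(ℝ, E).prod 𝓘(ℝ, E)) ∞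
      (fun y : E => TotalSpace.mk' E (E := fun x : M => TangentSpace 𝓘(ℝ, E) x)
        ((extChartAt 𝓘(ℝ, E) x).symm y)
        (H.J _ (mfderiv 𝓘(ℝ, E) 𝓘(ℝ, E) (extChartAt 𝓘(ℝ, E) x).symm y u)))
      (extChartAt 𝓘(ℝ, E) x x) := ContMDiffAt.clm_bundle_apply (F₁ := E) (F₂ := E)
    (ContMDiffAt.comp (extChartAt 𝓘(ℝ, E) x x) H.J_smooth.contMDiffAt hs)
    (contMDiffAt_mfderiv_extChartAt_symm x u)
  have hg : ContMDiffAt 𝓘(ℝ, E) (𝓘(ℝ, E).prod 𝓘(ℝ)) ∞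
      (fun y => TotalSpace.mk' ℝ (E := Bundle.Trivial M ℝ) ((extChartAt 𝓘(ℝ, E) x).symm y)
        (H.g.inner ((extChartAt 𝓘(ℝ, E) x).symm y)
          (H.J _ (mfderiv 𝓘(ℝ, E) 𝓘(ℝ, E) (extChartAt 𝓘(ℝ, E) x).symm y u))
          (mfderiv 𝓘(ℝ, E) 𝓘(ℝ, E) (extChartAt 𝓘(ℝ, E) x).symm y w)))
      (extChartAt 𝓘(ℝ, E) x x) :=
    ContMDiffAt.clm_bundle_apply₂ (F₁ := E) (F₂ := E)
      (ContMDiffAt.comp (extChartAt 𝓘(ℝ, E) x x) H.g.contMDiff.contMDiffAt hs) hJ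
      (contMDiffAt_mfderiv_extChartAt_symm x w)
  rw [contMDiffAt_totalSpace] at hg
  exact (contMDiffAt_iff_contDiffAt.1 hg.2).differentiableAt (by simp)

variable [FiniteDimensional ℝ E]

theorem inChart_L (α : FormField E M) (x : M) :
    inChart (H.L α) x = wedgeFamily (H.omegaInChart x) (inChart α x) := by
  funext k y
  apply ContinuousAlternatingMap.toAlternatingMap_injective
  exact congrFun (pullbackLM_wedgeTwoForm
    (mfderiv 𝓘(ℝ, E) 𝓘(ℝ, E) (extChartAt 𝓘(ℝ, E) x).symm y).toLinearMap
    (H.tangent ((extChartAt 𝓘(ℝ, E) x).symm y)).omega (α ((extChartAt 𝓘(ℝ, E) x).symm y))) k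

theorem differentiableInChart_L {α : FormField E M} {x : M} (hα : DifferentiableInChart α x) :
    DifferentiableInChart (H.L α) x := fun k => by
  rw [inChart_L]
  exact differentiableAt_wedgeFamily (H.differentiableAt_omegaInChart x) hα k

/-- The graded Leibniz rule `d(ω ∧ η) = dω ∧ η + ω ∧ dη` at a point, with `T = dω ∧ ·`. -/
theorem exists_d_L (x : M) :
    ∃ T : Module.End ℂ (Forms (TangentSpace 𝓘(ℝ, E) x)),
      (∀ ζ, T ((H.tangent x).lefschetz ζ) = (H.tangent x).lefschetz (T ζ)) ∧
      ∀ η : FormField E M, DifferentiableInChart η x →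
        d (H.L η) x = T (η x) + (H.tangent x).lefschetz (d η x) := by
  let y := extChartAt 𝓘(ℝ, E) x x
  let A : TangentSpace 𝓘(ℝ, E) x →ₗ[ℝ] E := chartDeriv x
  let D : E →ₗ[ℝ] TangentSpace 𝓘(ℝ, E) x :=
    (mfderiv 𝓘(ℝ, E) 𝓘(ℝ, E) (extChartAt 𝓘(ℝ, E) x).symm y).toLinearMap
  have hx : (extChartAt 𝓘(ℝ, E) x).symm y = x := extChartAt_to_inv x
  have hDA : D ∘ₗ A = LinearMap.id := by
    have := mfderivWithin_extChartAt_symm_comp_mfderiv_extChartAt' (I := 𝓘(ℝ, E))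
      (mem_extChartAt_source (I := 𝓘(ℝ, E)) x)
    rw [ModelWithCorners.range_eq_univ, mfderivWithin_univ] at this
    ext v
    exact congrArg (fun f => f v) this
  -- The point `(extChartAt 𝓘(ℝ, E) x).symm y` equals `x` only propositionally, and the tangent
  -- space depends on it. Reading all tangent spaces as `E` allows the base point to be rewritten.
  have hform : ∀ η : FormField E M, formAt (inChart η x) y = pullbackLM D (η x) := by
    intro η
    change pullbackLM D ((fun z : M => (η z : Forms E)) ((extChartAt 𝓘(ℝ, E) x).symm y)) = _
    rw [hx]
  have homega : H.omegaInChart x y = (H.tangent x).omega.compLinearMap D := by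
    change AlternatingMap.compLinearMap ((fun z : M => ((H.tangent z).omega : E [⋀^Fin 2]→ₗ[ℝ] ℝ))
      ((extChartAt 𝓘(ℝ, E) x).symm y)) D = _
    rw [hx]
  have hback : (H.omegaInChart x y).compLinearMap A = (H.tangent x).omega := by
    rw [homega]
    ext v
    change (H.tangent x).omega (fun i => (D ∘ₗ A) (v i)) = _
    rw [hDA]
    rfl
  refine ⟨pullbackLM A ∘ₗ wedgeExtDeriv (H.omegaInChart x) y ∘ₗ pullbackLM D, fun ζ => ?_,
    fun η hη => ?_⟩
  · simp only [LinearMap.comp_apply, ← L_eq, HermitianStructure.L]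
    rw [pullbackLM_wedgeTwoForm, ← homega, wedgeExtDeriv_wedgeTwoForm, pullbackLM_wedgeTwoForm,
      hback]
  · have h1 : extDerivForms (inChart (H.L η) x) y =
        wedgeExtDeriv (H.omegaInChart x) y (pullbackLM D (η x)) +
          wedgeTwoForm (H.omegaInChart x y) (extDerivForms (inChart η x) y) := by
      rw [inChart_L, ← hform]
      exact extDerivForms_wedgeFamily (H.differentiableAt_omegaInChart x) hη
    have h2 : ∀ ζ, pullbackLM A (wedgeTwoForm (H.omegaInChart x y) ζ) =
        (H.tangent x).lefschetz (pullbackLM A ζ) := by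
      intro ζ
      rw [pullbackLM_wedgeTwoForm, hback, ← L_eq, HermitianStructure.L]
    calc d (H.L η) x = pullbackLM A (extDerivForms (inChart (H.L η) x) y) := d_eq _ _
      _ = pullbackLM A (wedgeExtDeriv (H.omegaInChart x) y (pullbackLM D (η x))) +
          (H.tangent x).lefschetz (pullbackLM A (extDerivForms (inChart η x) y)) := by
        rw [h1, map_add, h2]
      _ = _ := congrArg _ (congrArg _ (d_eq η x).symm)

/-- The field `L^j α`. -/
def lefschetzPow (j : ℕ) (α : FormField E M) : FormField E M :=
  fun x => ((H.tangent x).lefschetz ^ j) (α x)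

theorem lefschetzPow_succ (j : ℕ) (α : FormField E M) :
    H.lefschetzPow (j + 1) α = H.L (H.lefschetzPow j α) := by
  funext x
  rw [L, L_eq, lefschetzPow, pow_succ']
  rfl

/-- Induction with the Leibniz rule, where `Z = dω ∧ η` at `x` does not depend on `j` because `dω ∧
·` commutes with `L`. The truncated exponent at `j = 0` has coefficient zero. -/
theorem exists_d_lefschetzPow (x : M) {η : FormField E M} (hη : DifferentiableInChart η x) :
    ∃ Z : Forms (TangentSpace 𝓘(ℝ, E) x), ∀ j, DifferentiableInChart (H.lefschetzPow j η) x ∧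
      d (H.lefschetzPow j η) x = (j : ℂ) • ((H.tangent x).lefschetz ^ (j - 1)) Z +
        ((H.tangent x).lefschetz ^ j) (d η x) := by
  obtain ⟨T, hT, hd⟩ := H.exists_d_L x
  have hTpow : ∀ j ζ, T (((H.tangent x).lefschetz ^ j) ζ) =
      ((H.tangent x).lefschetz ^ j) (T ζ) := by
    intro j ζ
    induction j with
    | zero => rfl
    | succ j ih =>
      rw [pow_succ', Module.End.mul_apply, hT, ih]
      rfl
  refine ⟨T (η x), fun j => ?_⟩
  induction j with
  | zero =>
    have h0 : H.lefschetzPow 0 η = η := rfl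
    rw [h0]
    exact ⟨hη, by simp⟩
  | succ j ih =>
    rw [lefschetzPow_succ]
    refine ⟨H.differentiableInChart_L ih.1, ?_⟩
    rw [hd _ ih.1, ih.2, map_add, map_smul, lefschetzPow, hTpow]
    have hpow : (j : ℂ) • (H.tangent x).lefschetz (((H.tangent x).lefschetz ^ (j - 1)) (T (η x))) =
        (j : ℂ) • ((H.tangent x).lefschetz ^ j) (T (η x)) := by
      cases j with
      | zero => simp
      | succ j => rw [pow_succ']; rfl
    rw [hpow, Nat.add_sub_cancel, pow_succ', Module.End.mul_apply, ← add_assoc]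
    push_cast
    module

theorem del_of_mem {p q : ℕ} {α : FormField E M} (hα : ∀ x, α x ∈ (H.tangent x).typePQ (p, q)) :
    H.del α = H.component (p + 1, q) (d α) := by
  have hself : H.component (p, q) α = α := funext fun x => (H.tangent x).component_of_mem (hα x)
  have hother : ∀ r, r ≠ (p, q) → H.component r α = 0 := fun r hr =>
    funext fun x => (H.tangent x).component_of_mem_ne (hα x) hr.symm
  have hzero : ∀ r, H.component r (0 : FormField E M) = 0 := fun r =>
    funext fun x => map_zero ((H.tangent x).component r)
  funext x k
  rw [del]
  have hterm : ∀ a b, (a, b) ≠ (p, q) → H.component (a + 1, b) (d (H.component (a, b) α)) x k = 0 :=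
    fun a b hab => by rw [hother _ hab, d_zero, hzero]; rfl
  by_cases hk : p < k ∧ q < k
  · rw [Finset.sum_eq_single p, Finset.sum_eq_single q, hself]
    · exact fun b _ hb => hterm p b (by simp [hb])
    · simp [hk.2]
    · exact fun a _ ha => Finset.sum_eq_zero fun b _ => hterm a b (by simp [ha])
    · simp [hk.1]
  -- If `(p,q)` falls outside the summation range, then `k < p + q + 1`, so a form of type `(p+1,q)`
  -- has no part of degree `k`.
  · rw [Finset.sum_eq_zero]
    · refine (apply_eq_zero_of_degree ((H.tangent x).degree_of_mem
        ((H.tangent x).component_mem (p + 1, q) (d α x))) ?_).symm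
      omega
    · intro a ha
      refine Finset.sum_eq_zero fun b hb => hterm a b ?_
      rintro hab
      obtain ⟨rfl, rfl⟩ := Prod.mk.inj hab
      exact hk ⟨Finset.mem_range.1 ha, Finset.mem_range.1 hb⟩

/-- The operator `∂` on the forms `c L^j α` for `α` of type `(0,q)`. -/
theorem exists_del_lefschetzPow {q : ℕ} {α : FormField E M} (hα : IsSmooth α)
    (hq : ∀ x, α x ∈ (H.tangent x).typePQ (0, q)) (x : M) :
    ∃ X : Forms (TangentSpace 𝓘(ℝ, E) x), ∀ (c : ℂ) (j : ℕ),
      H.del (c • H.lefschetzPow j α) x =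
        c • ((j : ℂ) • ((H.tangent x).lefschetz ^ (j - 1)) X +
          ((H.tangent x).lefschetz ^ j) (H.del α x)) := by
  obtain ⟨Z, hZ⟩ := H.exists_d_lefschetzPow x (hα.differentiableInChart x)
  -- With `Z = dω ∧ α`, the type `(2, q+1)` is the one that `L^(j-1)` carries to `(j+1, q+j)`, the
  -- type selected by `∂(L^j α)`.
  refine ⟨(H.tangent x).component (2, q + 1) Z, fun c j => ?_⟩
  have hmem : ∀ x, (c • H.lefschetzPow j α) x ∈ (H.tangent x).typePQ (0 + j, q + j) := fun x =>
    Submodule.smul_mem _ _ ((H.tangent x).lefschetz_pow_mem j (hq x))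
  rw [H.del_of_mem hmem, H.del_of_mem hq, component, d_smul (hZ j).1, (hZ j).2, map_smul, map_add,
    map_smul, component, add_right_comm, component_lefschetz_pow]
  congr 2
  cases j with
  | zero => simp
  | succ j =>
    rw [Nat.add_sub_cancel, ← component_lefschetz_pow]
    congr 4 <;> omega

end AlmostHermitianStructure

/-! ### The identity on the manifold -/

namespace AlmostHermitianStructure

open HermitianStructure

variable {E : Type*} [NormedAddCommGroup E] [NormedSpace ℝ E] [FiniteDimensional ℝ E]
variable {M : Type*} [TopologicalSpace M] [ChartedSpace E M] [IsManifold 𝓘(ℝ, E) ∞ M]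
variable (H : AlmostHermitianStructure E M)

theorem del_zero : H.del (0 : FormField E M) = 0 := by
  rw [H.del_of_mem (α := 0) (p := 0) (q := 0) fun x => Submodule.zero_mem _, d_zero]
  exact funext fun x => map_zero ((H.tangent x).component _)

theorem L_zero : H.L (0 : FormField E M) = 0 :=
  funext fun x => by rw [L, L_eq]; exact map_zero _

theorem Lam_zero : H.Lam (0 : FormField E M) = 0 :=
  funext fun x => by rw [Lam, Lam_eq]; exact map_zero _

theorem hodgeStar_zero : H.hodgeStar (0 : FormField E M) = 0 :=
  funext fun x => map_zero ((H.tangent x).star)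

theorem delbarStar_zero : H.delbarStar (0 : FormField E M) = 0 := by
  rw [delbarStar, hodgeStar_zero, del_zero, hodgeStar_zero, neg_zero]

theorem Lam_del_eq {q m : ℕ} {α : FormField E M} (hα : IsSmooth α)
    (hq : ∀ x, α x ∈ (H.tangent x).typePQ (0, q)) (hm : Module.finrank ℝ E / 2 = q + m) :
    H.Lam (H.del α) = Complex.I • H.delbarStar α +
      Complex.I • (H.Lam (H.delbarStar (H.L α)) - H.delbarStar (H.Lam (H.L α))) := by
  have hLam : H.Lam (H.L α) = (m : ℂ) • α := funext fun x => by
    rw [Lam, L, L_eq, Lam_eq]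
    exact (H.tangent x).dualLefschetz_lefschetz_of_mem (hq x) m hm
  have hstar : H.hodgeStar α = (starCoeff q / m.factorial) • H.lefschetzPow m α :=
    funext fun x => (H.tangent x).star_of_mem (hq x) m hm
  have hstarL : H.hodgeStar (H.L α) =
      (starCoeff q / m.factorial * m) • H.lefschetzPow (m - 1) α := funext fun x => by
    rw [hodgeStar, L, L_eq]
    exact (H.tangent x).star_lefschetz_of_mem (hq x) m hm
  have hstarm : H.hodgeStar ((m : ℂ) • α) =
      (starCoeff q / m.factorial * m) • H.lefschetzPow m α := by
    rw [mul_comm, mul_smul, ← hstar]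
    exact funext fun x => map_smul (H.tangent x).star _ _
  funext x
  -- The stars above are equalities of fields, as `∂` requires. From here on the identity is
  -- pointwise, with one `X` for both exponents `m` and `m - 1`.
  obtain ⟨X, hX⟩ := H.exists_del_lefschetzPow hα hq x
  have hY : H.del α x ∈ (H.tangent x).typePQ (1, q) := by
    rw [H.del_of_mem hq]
    exact (H.tangent x).component_mem _ _
  have key := (H.tangent x).dualLefschetz_eq_commutator X hY m hm
  simp only [← hX] at key
  rw [hLam]
  simp only [Pi.add_apply, Pi.smul_apply, Pi.sub_apply, Lam, Lam_eq, delbarStar, Pi.neg_apply,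
    hstar, hstarL, hstarm]
  exact key

end AlmostHermitianStructure

end AlmostHermitian

end

theorem proposition4p1
    {E : Type*} [NormedAddCommGroup E] [NormedSpace ℝ E] [FiniteDimensional ℝ E]
    {M : Type*} [TopologicalSpace M] [ChartedSpace E M] [IsManifold 𝓘(ℝ, E) ∞ M]
    (H : AlmostHermitian.AlmostHermitianStructure E M) (q : ℕ) (α : AlmostHermitian.FormField E M) (hα : AlmostHermitian.IsSmooth α)
    (hq : ∀ x : M, α x ∈ (H.tangent x).typePQ (0, q)) :
    H.Lam (H.del α) = Complex.I • H.delbarStar α +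
      Complex.I • (H.Lam (H.delbarStar (H.L α)) - H.delbarStar (H.Lam (H.L α))) := by
  rcases Nat.lt_or_ge (Module.finrank ℝ E / 2) q with hlt | hge
  -- No exponent `m = n - q` exists when `q > n`, but then there are no nonzero forms of type
  -- `(0,q)`.
  · obtain rfl : α = 0 := funext fun x => (H.tangent x).eq_zero_of_mem (hq x) hlt
    rw [H.del_zero, H.L_zero, H.Lam_zero, H.delbarStar_zero, H.Lam_zero]
    simp
  · obtain ⟨m, hm⟩ := Nat.exists_eq_add_of_le hge
    exact H.Lam_del_eq hα hq hm
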